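/- **Setting.** A Markov decision process (MDP) $P=((V,E),\langle V_1,V_R\rangle,\delta)$ has a finite vertex set $V=V_1\,\dot\cup\,V_R$, edges $E\subseteq V\times V$ without self-loops such that every vertex has an outgoing edge, and $\delta$ assigns to each $v\in V_R$ a probability distribution whose support is the set of successors of $v$; $n=|V|$, and $\log$ is the logarithm to base $2$. $P[X]$ is the restriction to $X$. A set-based symbolic algorithm accesses the MDP only by symbolic operations, each of which counts $1$: $\cup,\cap,\setminus,\times,\subseteq,=$ on sets of vertices or of edges, $\mathrm{Pre}_E(S)$ and $\mathrm{Post}_E(S)$ (the predecessors and successors of $S$), the cardinality $|S|$, and $\mathrm{Pick}(S)$, which returns an arbitrary element of a non-empty set $S$. **Subroutines.** * $\mathrm{SCCFind}_P(X,\cdot)$ is the symbolic SCC algorithm of Gentilini, Piazza and Policriti on the subgraph induced by $X$, called recursively with a skeleton $S$ and a set $N$ (initially $S=N=\emptyset$). If $X=\emptyset$, stop. If $S=\emptyset$, set $N=\{\mathrm{Pick}(X)\}$. Compute by breadth-first search the set $FW$ of vertices reachable from $N$ in $X$, with its layers, and then a new skeleton $S'$ with end set $N'$: pick a vertex of the last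 layer, which forms $N'$, and go back layer by layer, each time adding a picked vertex of the layer that is a predecessor of $S'$. Compute by backward search the set $C$ of vertices of $FW$ that can reach $N$ inside $FW$; output $C$. Recurse on $X\setminus FW$ with $S\setminus C$ and $\mathrm{Pre}(C\cap S)\cap(S\setminus C)$, then on $FW\setminus C$ with $S'\setminus C$ and $N'\setminus C$. With a start vertex $v$, $\mathrm{SCCFind}_P(X,\{v\})$ runs one round with $N=\{v\}$ and returns $C$. * $\mathrm{Attr}(P,T)=\bigcup_i A_i$, where $A_0=T$ and $A_{i+1}=A_i\cup(\mathrm{Pre}(A_i)\setminus(V_1\cap \mathrm{Pre}(V\setminus A_i)))$; the $A_i$ are computed until $A_{i+1}=A_i$. * $\mathrm{ROut}_P(S)=\mathrm{Pre}(V\setminus S)\cap(S\cap V_R)$. * $\mathrm{CollapseEC}(X,P)$ picks $v\in X\cap V_1$ if this set is non-empty, and otherwise picks $v\in X$ and moves $v$ from $V_R$ to $V_1$. It adds the edges $(\mathrm{Pre}(X)\setminus X)\times\{v\}$ and $\{v\}\times(\mathrm{Post}(X)\setminus X)$, then deletes all edges incident to $X\setminus\{v\}$ and removes $X\setminus\{v\}$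 from $V$, $V_1$ and $V_R$. * $\mathrm{Separator}(X,r,\gamma)$. Put $q=\lfloor\gamma/(2\log|X|)\rfloor$, $i=0$, $K=\{r\}$, $c=0$, $L=R=\emptyset$. While $\mathrm{Post}(K)\cap X\not\subseteq K$, do the following with $Z=(\mathrm{Post}(K)\setminus K)\cap X$: if $q\le i\le\gamma/2$, $L=\emptyset$ and $|Z|\le 2^{i/q-1}$, set $L=Z$; if $\gamma/2\le i\le\gamma-q$ and $|Z|\le2^{(\gamma-i)/q-1}$, set $R=Z$; if $i\le\gamma/2$, add $|Z|$ to $c$; then replace $K$ by $K\cup(\mathrm{Post}(K)\cap X)$ and $i$ by $i+1$. If now $i<\gamma$, reset all variables and repeat with $\mathrm{Pre}$ in place of $\mathrm{Post}$, as long as also $i\le\gamma$. If still $i<\gamma$, return $\emptyset$; otherwise return $L$ if $c<|X|/2$, and $R$ if not. **The algorithms.** $\mathrm{SymMec}(S,\gamma,P)$ takes a strongly connected set $S$ and may modify $P$ in place: 1. $M=\emptyset$. If $|S|\le1$, return $\emptyset$. If $\mathrm{ROut}_P(S)=\emptyset$, call $\mathrm{CollapseEC}(S,P)$ and return $S$.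 2. $T=\mathrm{Separator}(S,\mathrm{Pick}(S),\gamma)$. 3. If $T=\emptyset$: let $X=\mathrm{Attr}(P[S],\mathrm{ROut}_P(S))$, set $M=M\cup\mathrm{SymMec}(S_j,\gamma,P)$ for every SCC $S_j$ found by $\mathrm{SCCFind}_P(S\setminus X,\emptyset)$, and return $M$. 4. If $T\ne\emptyset$: let $A=\mathrm{Attr}(P[S],T)$ and set $M=M\cup\mathrm{SymMec}(S_j,\gamma,P)$ for every SCC $S_j$ found by $\mathrm{SCCFind}_P(S\setminus A,\emptyset)$. Then, while $T\neq\emptyset$: pick $v\in T$, set $T=T\setminus\{v\}$ and $S'=\mathrm{SCCFind}_P(S\setminus T,\{v\})$; if $|S'|=1$, continue; set $S'=S'\setminus\mathrm{Attr}(P[S'],\mathrm{ROut}_P(S'))$; if $S'\ne\emptyset$, set $U=\mathrm{SCCFind}_P(S',\{v\})$, call $\mathrm{CollapseEC}(U,P)$ and set $M=M\cup U$. Return $M$. $\mathrm{SymbolicMEC}(P',\gamma)$ makes a copy $P$ of $P'$, sets $M=\bigcup_C\mathrm{SymMec}(C,\gamma,P)$ over the SCCs $C$ found by $\mathrm{SCCFind}_{P'}(V',\emptyset)$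 one after the other (the same $P$ is updated by all calls), and returns the SCCs found by $\mathrm{SCCFind}_{P'}(M,\emptyset)$. **Proposition.** There is an absolute constant $c$ such that for every MDP $P$ with $n$ vertices, every natural number $\gamma$ with $\lfloor\gamma/(2\log n)\rfloor\ge1$, and every way in which the $\mathrm{Pick}$ operations are resolved, the following holds: for every strongly connected non-empty set $S$ of vertices of $P$, the call $\mathrm{SymMec}(S,\gamma,P)$ terminates after at most $$c\left(n\gamma+\frac{n^2}{\lfloor\gamma/(2\log n)\rfloor}\right)$$ symbolic operations, and $\mathrm{SymbolicMEC}(P,\gamma)$ also terminates after at most this number of symbolic operations. -/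

import Mathlib

/-! ### Markov decision processes -/

/-- The part of an MDP that a set-based symbolic algorithm can access and update: the vertex set,
the edge set and the sets of player-1 and random vertices, each one stored as a set. -/
structure SymGraph (α : Type) where
  V : Finset α
  E : Finset (α × α)
  V1 : Finset α
  VR : Finset α

/-- A Markov decision process whose vertices are elements of `α`. The vertices are partitioned into
player-1 vertices and random vertices, `δ` maps each random vertex to a probability distribution
whose support is the set of its successors, there are no self-loops, and each vertex has an outgoing
edge. -/
structure MDP (α : Type) [DecidableEq α] extends SymGraph α where
  V1_union_VR : V1 ∪ VR = V
  V1_disjoint_VR : Disjoint V1 VR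
  E_subset : E ⊆ V ×ˢ V
  δ : {v : α // v ∈ VR} → PMF α
  mem_E_iff : ∀ (v : {v : α // v ∈ VR}) (w : α), ((v : α), w) ∈ E ↔ 0 < δ v w
  no_loop : ∀ v, (v, v) ∉ E
  exists_out : ∀ v ∈ V, ∃ w, (v, w) ∈ E

/-- `S` is a non-empty set of vertices, and the subgraph induced by `S` is strongly connected. -/
def SymGraph.StronglyConnected {α : Type} (P : SymGraph α) (S : Finset α) : Prop :=
  S.Nonempty ∧ S ⊆ P.V ∧
    ∀ u ∈ S, ∀ v ∈ S, Relation.ReflTransGen (fun a b => a ∈ S ∧ b ∈ S ∧ (a, b) ∈ P.E) u v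

/-! ### The set-based symbolic model of computation

A symbolic computation carries the number of symbolic operations executed so far. The outcome `none`
means that the computation does not terminate, or that it picks a vertex from the empty set. -/

/-- Symbolic computations. -/
abbrev SymM : Type → Type := StateT ℕ Option

namespace SymOp

variable {β : Type}

/-- One symbolic operation with result `b`. -/
def one (b : β) : SymM β := fun t => some (b, t + 1)

section Sets

variable [DecidableEq β]

/-! Basic set operations, on sets of vertices or on sets of edges. -/

def union (A B : Finset β) : SymM (Finset β) := one (A ∪ B)

def inter (A B : Finset β) : SymM (Finset β) := one (A ∩ B)

def sdiff (A B : Finset β) : SymM (Finset β) := one (A \ B)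

def prod (A B : Finset β) : SymM (Finset (β × β)) := one (A ×ˢ B)

def subset (A B : Finset β) : SymM Bool := one (decide (A ⊆ B))

def isEmpty (A : Finset β) : SymM Bool := one (decide (A = ∅))

def equal (A B : Finset β) : SymM Bool := one (decide (A = B))

/-! One-step operations. -/

def pre (P : SymGraph β) (S : Finset β) : SymM (Finset β) :=
  one (P.V.filter fun v => ∃ w ∈ S, (v, w) ∈ P.E)

def post (P : SymGraph β) (S : Finset β) : SymM (Finset β) :=
  one (P.V.filter fun v => ∃ w ∈ S, (w, v) ∈ P.E)

end Sets

def card (A : Finset β) : SymM ℕ := one A.card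

/-- `Pick`. The oracle `ch` resolves the arbitrary choices. It also sees the number of operations
executed so far, so that two picks from the same set need not agree. -/
def pick (ch : ℕ → Finset β → β) (A : Finset β) : SymM β :=
  fun t => if A.Nonempty then some (ch t A, t + 1) else none

end SymOp

/-- `while cond do body`, for a loop with variables `s`. -/
def whileM {σ : Type} (cond : σ → SymM Bool) (body : σ → SymM σ) (s : σ) : SymM σ := do
  if (← cond s) then
    let s₁ ← body s
    whileM cond body s₁
  else
    pure s
  partial_fixpoint

namespace Symbolic

open SymOp

section Algorithms

variable {α : Type} [DecidableEq α]

/-! ### Strongly connected components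

The skeleton-based algorithm that needs a linear number of symbolic operations. -/

/-- State of the forward search: the set of visited vertices, the current layer, and the stack of the
earlier layers. -/
structure FwState (α : Type) where
  FW : Finset α
  L : Finset α
  stack : List (Finset α)

/-- Breadth-first search in the subgraph induced by `X` from the set `N`. -/
def forwardLayers (P : SymGraph α) (X N : Finset α) : SymM (FwState α) :=
  whileM (fun s => do pure (! (← isEmpty s.L)))
    (fun s => do
      let FW ← union s.FW s.L
      let L ← sdiff (← inter (← post P s.L) X) FW
      pure ⟨FW, L, s.L :: s.stack⟩)
    ⟨∅, N, []⟩

/-- The vertices reachable from `N` in the subgraph induced by `X`, a skeleton (the vertices of a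
shortest path from `N` to a vertex at maximal distance), and the set of the end vertex of this path.
-/
def skelForward (ch : ℕ → Finset α → α) (P : SymGraph α) (X N : Finset α) :
    SymM (Finset α × Finset α × Finset α) := do
  let s ← forwardLayers P X N
  match s.stack with
  | [] => pure (s.FW, ∅, ∅)
  | L :: rest =>
    let x ← pick ch L
    let skel ← rest.foldlM (init := ({x} : Finset α)) fun sk L => do
      let y ← pick ch (← inter (← pre P sk) L)
      union sk {y}
    pure (s.FW, skel, {x})

/-- The vertices of `FW` that can reach `N` inside `FW`. -/
def backwardIn (P : SymGraph α) (FW N : Finset α) : SymM (Finset α) :=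
  whileM (fun C => do pure (! (← isEmpty (← sdiff (← inter (← pre P C) FW) C))))
    (fun C => do union C (← inter (← pre P C) FW))
    N

/-- One round of the SCC algorithm: the forward set of `N` in the subgraph induced by `X`, the SCC
of `N`, and the skeleton of the forward set with its end vertex. -/
def sccRound (ch : ℕ → Finset α → α) (P : SymGraph α) (X N : Finset α) :
    SymM (Finset α × Finset α × Finset α × Finset α) := do
  let (FW, newS, newN) ← skelForward ch P X N
  let C ← backwardIn P FW N
  pure (FW, C, newS, newN)

/-- The start set of a round: the end `N` of the skeleton `S`, or an arbitrary vertex if there is no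
skeleton. -/
def startSet (ch : ℕ → Finset α → α) (X S N : Finset α) : SymM (Finset α) := do
  if (← isEmpty S) then
    let v ← pick ch X
    pure {v}
  else
    pure N

/-- The list of the SCCs of the subgraph induced by `X`, in the order in which they are found, where
`S` is a skeleton with end vertex in `N`, or empty. -/
def sccRec (ch : ℕ → Finset α → α) (P : SymGraph α) (X S N : Finset α) :
    SymM (List (Finset α)) := do
  if (← isEmpty X) then
    pure []
  else
    let start ← startSet ch X S N
    let (FW, C, newS, newN) ← sccRound ch P X start
    let X₁ ← sdiff X FW
    let S₁ ← sdiff S C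
    let N₁ ← inter (← pre P (← inter C S)) S₁
    let l₁ ← sccRec ch P X₁ S₁ N₁
    let X₂ ← sdiff FW C
    let S₂ ← sdiff newS C
    let N₂ ← sdiff newN C
    let l₂ ← sccRec ch P X₂ S₂ N₂
    pure (C :: (l₁ ++ l₂))
  partial_fixpoint

/-- `SCCFind_P(X, ∅)`: all SCCs of the subgraph of `P` induced by `X`. -/
def sccFind (ch : ℕ → Finset α → α) (P : SymGraph α) (X : Finset α) : SymM (List (Finset α)) :=
  sccRec ch P X ∅ ∅

/-- `SCCFind_P(X, {v})`, halted after the first SCC, which is the SCC of the start vertex `v`. -/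
def sccOf (ch : ℕ → Finset α → α) (P : SymGraph α) (X : Finset α) (v : α) :
    SymM (Finset α) := do
  let (_, C, _, _) ← sccRound ch P X {v}
  pure C

/-! ### Random attractors -/

/-- `P[X]`. -/
def restrict (P : SymGraph α) (X : Finset α) : SymM (SymGraph α) := do
  let E ← inter (← prod X X) P.E
  let V1 ← inter X P.V1
  let VR ← inter X P.VR
  pure ⟨X, E, V1, VR⟩

/-- The level of the attractor that follows the level `A`. -/
def attrStep (P : SymGraph α) (A : Finset α) : SymM (Finset α) := do
  let Q ← pre P A
  let B ← inter P.V1 (← pre P (← sdiff P.V A))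
  union A (← sdiff Q B)

/-- The random attractor of `T` in `P`: the levels are computed until two consecutive ones agree. -/
def attr (P : SymGraph α) (T : Finset α) : SymM (Finset α) := do
  let A₁ ← attrStep P T
  let s ← whileM (fun s : Finset α × Finset α => do pure (! (← equal s.1 s.2)))
    (fun s => do
      let A ← attrStep P s.2
      pure (s.2, A))
    (T, A₁)
  pure s.2

/-- `ROut(S)`: the random vertices of `S` with an edge that leaves `S`. -/
def rOut (P : SymGraph α) (S : Finset α) : SymM (Finset α) := do
  inter (← pre P (← sdiff P.V S)) (← inter S P.VR)

/-! ### Separators -/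

/-- `⌊γ / (2 log k)⌋`. -/
noncomputable def quality (γ k : ℕ) : ℕ := ⌊(γ : ℝ) / (2 * Real.logb 2 k)⌋₊

/-- The variables of the breadth-first search in `Separator`. -/
structure SepState (α : Type) where
  i : ℕ
  K : Finset α
  c : ℕ
  L : Finset α
  R : Finset α

/-- The body of the two while loops of `Separator`, where `next` is `Post` or `Pre`. -/
noncomputable def sepBody (next : Finset α → SymM (Finset α)) (X : Finset α) (γ q : ℕ)
    (s : SepState α) : SymM (SepState α) := do
  let L ←
    if q ≤ s.i ∧ (s.i : ℝ) ≤ γ / 2 then do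
      let Z ← inter (← sdiff (← next s.K) s.K) X
      if (← isEmpty s.L) && decide (((← card Z : ℕ) : ℝ) ≤ (2 : ℝ) ^ ((s.i : ℝ) / q - 1)) then
        pure Z
      else
        pure s.L
    else
      pure s.L
  let R ←
    if (γ : ℝ) / 2 ≤ s.i ∧ (s.i : ℝ) ≤ (γ : ℝ) - q then do
      let Z ← inter (← sdiff (← next s.K) s.K) X
      if ((← card Z : ℕ) : ℝ) ≤ (2 : ℝ) ^ (((γ : ℝ) - s.i) / q - 1) then
        pure Z
      else
        pure s.R
    else
      pure s.R
  let c ←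
    if (s.i : ℝ) ≤ γ / 2 then do
      let k ← card (← inter (← sdiff (← next s.K) s.K) X)
      pure (s.c + k)
    else
      pure s.c
  let K ← union s.K (← inter (← next s.K) X)
  pure ⟨s.i + 1, K, c, L, R⟩

/-- The test `next(K) ∩ X ⊄ K`. -/
def sepCond (next : Finset α → SymM (Finset α)) (X : Finset α) (s : SepState α) : SymM Bool := do
  let b ← subset (← inter (← next s.K) X) s.K
  pure (! b)

/-- `Separator(X, r, γ)`. -/
noncomputable def separator (P : SymGraph α) (X : Finset α) (r : α) (γ : ℕ) :
    SymM (Finset α) := do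
  let k ← card X
  let q := quality γ k
  let s₁ ← whileM (sepCond (post P) X) (sepBody (post P) X γ q) ⟨0, {r}, 0, ∅, ∅⟩
  let s ←
    if s₁.i < γ then
      whileM (fun s => if s.i ≤ γ then sepCond (pre P) X s else pure false)
        (sepBody (pre P) X γ q) ⟨0, {r}, 0, ∅, ∅⟩
    else
      pure s₁
  if s.i < γ then
    pure ∅
  else if (s.c : ℝ) < (k : ℝ) / 2 then
    pure s.L
  else
    pure s.R

/-! ### The MEC algorithms -/

/-- The vertex that represents `X` after collapsing, with the updated sets `V1` and `VR`. -/
def collapseRep (ch : ℕ → Finset α → α) (X : Finset α) (P : SymGraph α) :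
    SymM (α × Finset α × Finset α) := do
  let X₁ ← inter X P.V1
  if (← isEmpty X₁) then
    let v ← pick ch X
    let V1 ← union P.V1 {v}
    let VR ← sdiff P.VR {v}
    pure (v, V1, VR)
  else
    let v ← pick ch X₁
    pure (v, P.V1, P.VR)

/-- `CollapseEC(X, P)`: the updated MDP. -/
def collapseEC (ch : ℕ → Finset α → α) (X : Finset α) (P : SymGraph α) : SymM (SymGraph α) := do
  let (v, V1, VR) ← collapseRep ch X P
  let inc ← prod (← sdiff (← pre P X) X) {v}
  let out ← prod {v} (← sdiff (← post P X) X)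
  let E ← union P.E (← union inc out)
  let Y ← sdiff X {v}
  let E ← sdiff E (← union (← prod P.V Y) (← prod Y P.V))
  let V ← sdiff P.V Y
  let V1 ← inter V1 V
  let VR ← inter VR V
  pure ⟨V, E, V1, VR⟩

/-- The variables of the incremental detection of ECs: the vertices of the separator that are still
to be added, the vertices found so far, and the MDP. -/
structure IncState (α : Type) where
  T : Finset α
  M : Finset α
  P : SymGraph α

/-- The body of the while loop that adds the vertices of the separator one by one. -/
def incBody (ch : ℕ → Finset α → α) (S : Finset α) (s : IncState α) : SymM (IncState α) := do
  let v ← pick ch s.T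
  let T ← sdiff s.T {v}
  let S' ← sccOf ch s.P (← sdiff S T) v
  if (← card S') = 1 then
    pure ⟨T, s.M, s.P⟩
  else
    let Z ← attr (← restrict s.P S') (← rOut s.P S')
    let S'' ← sdiff S' Z
    if (← isEmpty S'') then
      pure ⟨T, s.M, s.P⟩
    else
      let U ← sccOf ch s.P S'' v
      let P ← collapseEC ch U s.P
      let M ← union s.M U
      pure ⟨T, M, P⟩

/-- The while loop that adds the vertices of the separator `T` one by one. -/
def incDetect (ch : ℕ → Finset α → α) (S T M : Finset α) (P : SymGraph α) :
    SymM (Finset α × SymGraph α) := do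
  let s ← whileM (fun s => do pure (! (← isEmpty s.T))) (incBody ch S) ⟨T, M, P⟩
  pure (s.M, s.P)

/-- `SymMec(S, γ, P)`: the returned set `M`, and the MDP `P` as updated by the call. -/
noncomputable def symMec (ch : ℕ → Finset α → α) (γ : ℕ) (S : Finset α) (P : SymGraph α) :
    SymM (Finset α × SymGraph α) := do
  if (← card S) ≤ 1 then
    pure (∅, P)
  else if (← isEmpty (← rOut P S)) then
    let P₁ ← collapseEC ch S P
    pure (S, P₁)
  else
    let r ← pick ch S
    let T ← separator P S r γ
    if (← isEmpty T) then
      let X ← attr (← restrict P S) (← rOut P S)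
      let Cs ← sccFind ch P (← sdiff S X)
      Cs.foldlM (init := ((∅ : Finset α), P)) fun s C => do
        let p ← symMec ch γ C s.2
        let M ← union s.1 p.1
        pure (M, p.2)
    else
      let A ← attr (← restrict P S) T
      let Cs ← sccFind ch P (← sdiff S A)
      let s ← Cs.foldlM (init := ((∅ : Finset α), P)) fun s C => do
        let p ← symMec ch γ C s.2
        let M ← union s.1 p.1
        pure (M, p.2)
      incDetect ch S T s.1 s.2
  partial_fixpoint

/-- `SymbolicMec(P, γ)`: the list of the computed MECs. The SCCs are those of the input `P`, whereas
`SymMec` works on a copy of `P` that is passed from call to call. -/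
noncomputable def symbolicMec (ch : ℕ → Finset α → α) (γ : ℕ) (P : SymGraph α) :
    SymM (List (Finset α)) := do
  let Cs ← sccFind ch P P.V
  let s ← Cs.foldlM (init := ((∅ : Finset α), P)) fun s C => do
    let p ← symMec ch γ C s.2
    let M ← union s.1 p.1
    pure (M, p.2)
  sccFind ch P s.1

end Algorithms

end Symbolic

/-! The proof is an amortized count. Only termination, the number of operations and a few structural
facts about the results are tracked. `Spec` demands its postcondition from every start time, because
the oracle sees the clock.

SCC search. A round with start vertex `v` costs a constant times the length of the new skeleton plus
the diameter of the component `C` that is output. The skeleton is a shortest path, so it stores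
credit: 9 per vertex, spent when the vertex is output in a component. A shortest path meets `C` in
at most `diam C + 1` vertices, so the whole search costs at most `1 + 34 * ∑ (diam C + 1)` over the
components found (`sccRec_spec`).

Separators. When a search from `r` runs for `γ` iterations, suitable layers cannot all be large,
since sizes that exceed `2 ^ (j / q - 1)` would add up to more vertices than `X` has. A small layer
`T` then splits `X` into `A` and `B` with `q * |T| * |X| ≤ 2 * (|A| + |T|) * (|B| + |T|)`
(`SepInv.isSeparator`). If neither search gets that far, the diameter is at most `2 * γ`
(`separator_spec`).

`SymMec`. The cost on a set of `x` vertices is bounded by `150 * γ * x + 600 / q * x ^ 2`, where `q`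
is the quality for `n`. This bound also has to cover `34 * (diam + 1)`, the share of the parent's
SCC search that is charged to this set. Without a separator, the work outside the recursive calls is
of order `γ` plus the size of the attractor, which is removed and contains at least one vertex: the
linear term pays. With a separator, that work is of order `|T| * |S|`, and the drop `|S| ^ 2 - |A| ^
2 - |B| ^ 2` of the quadratic term pays (`separator_charge`). A call changes the MDP only inside its
own set, so components found earlier stay strongly connected with the same diameter while their
siblings are processed. -/

/-! ### A program logic for symbolic computations -/

/-- The computation `m` terminates at every start time, and its result `b` and the number `s` of its
operations satisfy `Q b s`. -/
def Spec {β : Type} (m : SymM β) (Q : β → ℕ → Prop) : Prop :=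
  ∀ t, ∃ b s, m t = some (b, t + s) ∧ Q b s

namespace Spec

variable {β δ : Type}

theorem mono {m : SymM β} {Q Q' : β → ℕ → Prop} (h : Spec m Q) (hQ : ∀ b s, Q b s → Q' b s) :
    Spec m Q' := fun t => by
  obtain ⟨b, s, hm, hb⟩ := h t
  exact ⟨b, s, hm, hQ b s hb⟩

theorem bind {m : SymM β} {f : β → SymM δ} {R : β → ℕ → Prop} {Q : δ → ℕ → Prop}
    (h : Spec m R) (hf : ∀ b s, R b s → Spec (f b) fun d s' => Q d (s + s')) :
    Spec (m >>= f) Q := fun t => by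
  obtain ⟨b, s, hm, hb⟩ := h t
  obtain ⟨d, s', hf', hd⟩ := hf b s hb (t + s)
  refine ⟨d, s + s', ?_, hd⟩
  change (m t).bind (fun p => f p.1 p.2) = _
  rw [hm, ← Nat.add_assoc]
  exact hf'

@[simp] theorem pure_iff {b : β} {Q : β → ℕ → Prop} : Spec (pure b : SymM β) Q ↔ Q b 0 := by
  constructor
  · intro h
    obtain ⟨b', s, hm, hb⟩ := h 0
    have hm' : some (b, 0) = some (b', 0 + s) := hm
    simp only [Option.some.injEq, Prod.mk.injEq, Nat.zero_add] at hm'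
    obtain ⟨rfl, rfl⟩ := hm'
    exact hb
  · exact fun h t => ⟨b, 0, rfl, h⟩

@[simp] theorem one_iff {b : β} {Q : β → ℕ → Prop} : Spec (SymOp.one b) Q ↔ Q b 1 := by
  constructor
  · intro h
    obtain ⟨b', s, hm, hb⟩ := h 0
    have hm' : some (b, 0 + 1) = some (b', 0 + s) := hm
    simp only [Option.some.injEq, Prod.mk.injEq, Nat.zero_add] at hm'
    obtain ⟨rfl, rfl⟩ := hm'
    exact hb
  · exact fun h t => ⟨b, 1, rfl, h⟩

@[simp] theorem pure_bind_iff {b : β} {f : β → SymM δ} {Q : δ → ℕ → Prop} :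
    Spec (pure b >>= f) Q ↔ Spec (f b) Q := Iff.rfl

theorem one_bind {b : β} {f : β → SymM δ} {Q : δ → ℕ → Prop}
    (h : Spec (f b) fun d s => Q d (s + 1)) : Spec (SymOp.one b >>= f) Q :=
  bind (R := fun b' s => b' = b ∧ s = 1) (one_iff.2 ⟨rfl, rfl⟩) fun _ _ ⟨h₁, h₂⟩ => by
    subst h₁ h₂; simpa only [Nat.add_comm] using h

theorem pick {ch : ℕ → Finset β → β} (hch : ∀ t A, A.Nonempty → ch t A ∈ A) {A : Finset β}
    (hA : A.Nonempty) {Q : β → ℕ → Prop} (h : ∀ a ∈ A, Q a 1) : Spec (SymOp.pick ch A) Q :=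
  fun t => ⟨ch t A, 1, if_pos hA, h _ (hch t A hA)⟩

theorem pick_bind {ch : ℕ → Finset β → β} (hch : ∀ t A, A.Nonempty → ch t A ∈ A) {A : Finset β}
    (hA : A.Nonempty) {f : β → SymM δ} {Q : δ → ℕ → Prop}
    (h : ∀ a ∈ A, Spec (f a) fun d s => Q d (s + 1)) : Spec (SymOp.pick ch A >>= f) Q :=
  bind (R := fun a s => a ∈ A ∧ s = 1) (pick hch hA fun _ ha => ⟨ha, rfl⟩) fun a s ⟨ha, hs⟩ => by
    subst hs; simpa only [Nat.add_comm] using h a ha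

/-- The rule for loops, where `i` counts the iterations. -/
theorem whileM {σ : Type} {cond : σ → SymM Bool} {body : σ → SymM σ} {I : ℕ → σ → Prop}
    {G : σ → Prop} {B kc kb : ℕ} (hB : ∀ i s, I i s → i ≤ B)
    (hc : ∀ i s, I i s → Spec (cond s) fun b c => c ≤ kc ∧ (b = true ↔ G s))
    (hb : ∀ i s, I i s → G s → Spec (body s) fun s' c => c ≤ kb ∧ I (i + 1) s')
    {s : σ} (hs : I 0 s) :
    Spec (_root_.whileM cond body s) fun s' c =>
      ∃ j, I j s' ∧ ¬ G s' ∧ c ≤ kc + (kc + kb) * j := by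
  -- Induction on the number of iterations still allowed by `B`. With none left, one more iteration
  -- would violate `hB`. The test runs once more often than the body, hence the extra `kc`.
  suffices H : ∀ d i s, B - i ≤ d → I i s → Spec (_root_.whileM cond body s) fun s' c =>
      ∃ j, I (i + j) s' ∧ ¬ G s' ∧ c ≤ kc + (kc + kb) * j by
    simpa using H B 0 s (Nat.sub_le _ _) hs
  intro d
  induction d with
  | zero =>
    intro i s hd hI
    rw [_root_.whileM]
    refine bind (hc i s hI) fun b c ⟨hc₁, hbG⟩ => ?_
    by_cases hG : G s
    · rw [if_pos (hbG.2 hG)]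
      refine bind (hb i s hI hG) fun s₁ c₁ ⟨_, h₂⟩ => ?_
      have := hB _ _ h₂
      omega
    · rw [if_neg (mt hbG.1 hG), pure_iff]
      exact ⟨0, hI, hG, by omega⟩
  | succ d ih =>
    intro i s hd hI
    rw [_root_.whileM]
    refine bind (hc i s hI) fun b c ⟨hc₁, hbG⟩ => ?_
    by_cases hG : G s
    · rw [if_pos (hbG.2 hG)]
      refine bind (hb i s hI hG) fun s₁ c₁ ⟨h₁, h₂⟩ => ?_
      have := hB _ _ h₂
      refine (ih (i + 1) s₁ (by omega) h₂).mono fun s' c' ⟨j, hj₁, hj₂, hj₃⟩ => ?_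
      refine ⟨j + 1, by rwa [show i + (j + 1) = i + 1 + j by omega], hj₂, ?_⟩
      rw [Nat.mul_add]
      omega
    · rw [if_neg (mt hbG.1 hG), pure_iff]
      exact ⟨0, hI, hG, by omega⟩

theorem ite_iff {c : Prop} [Decidable c] {m m' : SymM β} {Q : β → ℕ → Prop} :
    Spec (if c then m else m') Q ↔ (c → Spec m Q) ∧ (¬ c → Spec m' Q) := by
  split_ifs with h <;> simp [h]

end Spec

/-! ### Walks and diameters -/

/-- There is a walk of length `n` from `a` to `b`. -/
inductive Walk {α : Type} (r : α → α → Prop) : ℕ → α → α → Prop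
  | nil (a : α) : Walk r 0 a a
  | snoc {n : ℕ} {a b c : α} : Walk r n a b → r b c → Walk r (n + 1) a c

namespace Walk

variable {α : Type} {r r' : α → α → Prop} {a b c : α} {m n : ℕ}

theorem mono (h : ∀ a b, r a b → r' a b) (w : Walk r n a b) : Walk r' n a b := by
  induction w with
  | nil a => exact .nil a
  | snoc _ hr ih => exact .snoc ih (h _ _ hr)

theorem trans (w : Walk r m a b) (w' : Walk r n b c) : Walk r (m + n) a c := by
  induction w' with
  | nil a => exact w
  | snoc _ hr ih => exact .snoc (ih w) hr

theorem single (h : r a b) : Walk r 1 a b := .snoc (.nil a) h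

theorem cons (h : r a b) (w : Walk r n b c) : Walk r (n + 1) a c := by
  rw [Nat.add_comm]
  exact (single h).trans w

theorem reverse (w : Walk r n a b) : Walk (fun x y => r y x) n b a := by
  induction w with
  | nil a => exact .nil a
  | snoc _ hr ih => exact .cons hr ih

end Walk

namespace SymGraph

variable {α : Type}

/-- The edges of the subgraph induced by `X`. -/
def Inside (P : SymGraph α) (X : Finset α) (a b : α) : Prop := a ∈ X ∧ b ∈ X ∧ (a, b) ∈ P.E

/-- Any two vertices of `C` are joined by a walk of length at most `d` inside `C`. -/
def DiamLE (P : SymGraph α) (C : Finset α) (d : ℕ) : Prop :=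
  ∀ u ∈ C, ∀ v ∈ C, ∃ m ≤ d, Walk (P.Inside C) m u v

/-- The diameter of the subgraph induced by `C`. -/
noncomputable def diam (P : SymGraph α) (C : Finset α) : ℕ := sInf {d | P.DiamLE C d}

variable {P P' : SymGraph α} {C X : Finset α}

theorem Inside.mono (h : C ⊆ X) {a b : α} (hab : P.Inside C a b) : P.Inside X a b :=
  ⟨h hab.1, h hab.2.1, hab.2.2⟩

theorem StronglyConnected.exists_edge_leaving (h : P.StronglyConnected C) {B : Finset α} {u v : α}
    (hu : u ∈ C) (hv : v ∈ C) (huB : u ∈ B) (hvB : v ∉ B) :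
    ∃ a b, P.Inside C a b ∧ a ∈ B ∧ b ∉ B := by
  have H := h.2.2 u hu v hv
  induction H with
  | refl => exact absurd huB hvB
  | @tail x y _ hr ih =>
    by_cases hx : x ∈ B
    · exact ⟨x, y, hr, hx, hvB⟩
    · exact ih hr.1 hx

theorem StronglyConnected.diamLE_card (h : P.StronglyConnected C) : P.DiamLE C C.card := by
  classical
  intro u hu v hv
  set B : ℕ → Finset α := fun n => C.filter fun v => ∃ m ≤ n, Walk (P.Inside C) m u v with hB
  -- `B n` is the ball of radius `n` around `u`. By strong connectivity it gains a vertex with each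
  -- unit of radius until it is all of `C`.
  have key : ∀ n, n + 1 ≤ (B n).card ∨ B n = C := by
    intro n
    induction n with
    | zero =>
      left
      refine Finset.card_pos.2 ⟨u, ?_⟩
      simp only [hB, Finset.mem_filter]
      exact ⟨hu, 0, le_rfl, .nil u⟩
    | succ n ih =>
      have hmono : B n ⊆ B (n + 1) := fun x hx => by
        simp only [hB, Finset.mem_filter] at hx ⊢
        obtain ⟨hx, m, hm, w⟩ := hx
        exact ⟨hx, m, by omega, w⟩
      by_cases hBC : B n = C
      · right
        exact (Finset.filter_subset _ _).antisymm fun x hx => hmono (hBC.symm ▸ hx)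
      · left
        have ih := ih.resolve_right hBC
        obtain ⟨x, hxC, hx⟩ : ∃ x ∈ C, x ∉ B n := by
          by_contra! hcon
          exact hBC ((Finset.filter_subset _ _).antisymm hcon)
        have huB : u ∈ B n := by
          simp only [hB, Finset.mem_filter]
          exact ⟨hu, 0, Nat.zero_le _, .nil u⟩
        obtain ⟨a, b, hab, ha, hb⟩ := h.exists_edge_leaving hu hxC huB hx
        have hb' : b ∈ B (n + 1) := by
          simp only [hB, Finset.mem_filter] at ha ⊢
          obtain ⟨_, m, hm, w⟩ := ha
          exact ⟨hab.2.1, m + 1, by omega, w.snoc hab⟩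
        have := Finset.card_lt_card (Finset.ssubset_iff_of_subset hmono |>.2 ⟨b, hb', hb⟩)
        omega
  have hv' : v ∈ B C.card := by
    rcases key C.card with h' | h'
    · exact absurd (Finset.card_le_card (Finset.filter_subset _ _ : B C.card ⊆ C))
        (Nat.not_le.2 h')
    · exact h'.symm ▸ hv
  simp only [hB, Finset.mem_filter] at hv'
  exact hv'.2

/-- The infimum is attained because `diamLE_card` provides one bound. Without any bound `diam` would
take the default value 0. -/
theorem StronglyConnected.diamLE_diam (h : P.StronglyConnected C) : P.DiamLE C (P.diam C) :=
  Nat.sInf_mem (s := {d | P.DiamLE C d}) ⟨_, h.diamLE_card⟩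

theorem DiamLE.diam_le {d : ℕ} (h : P.DiamLE C d) : P.diam C ≤ d := Nat.sInf_le h

theorem StronglyConnected.diam_le_card (h : P.StronglyConnected C) : P.diam C ≤ C.card :=
  h.diamLE_card.diam_le

/-- `P'` arises from `P` by changes that concern only vertices of `S` and edges incident to `S`. -/
def ChangedIn (P P' : SymGraph α) (S : Finset α) : Prop :=
  (∀ a ∈ P.V, a ∉ S → a ∈ P'.V) ∧ ∀ a b, a ∉ S → b ∉ S → ((a, b) ∈ P'.E ↔ (a, b) ∈ P.E)

theorem ChangedIn.refl (P : SymGraph α) (S : Finset α) : P.ChangedIn P S :=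
  ⟨fun _ h _ => h, fun _ _ _ _ => Iff.rfl⟩

theorem ChangedIn.trans {P'' : SymGraph α} {S : Finset α} (h : P.ChangedIn P' S)
    (h' : P'.ChangedIn P'' S) : P.ChangedIn P'' S :=
  ⟨fun a ha hS => h'.1 a (h.1 a ha hS) hS,
    fun a b ha hb => (h'.2 a b ha hb).trans (h.2 a b ha hb)⟩

theorem ChangedIn.mono {S S' : Finset α} (h : P.ChangedIn P' S) (hS : S ⊆ S') :
    P.ChangedIn P' S' :=
  ⟨fun a ha ha' => h.1 a ha fun hh => ha' (hS hh),
    fun a b ha hb => h.2 a b (fun hh => ha (hS hh)) fun hh => hb (hS hh)⟩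

theorem ChangedIn.inside_eq {S : Finset α} (h : P.ChangedIn P' S) (hd : Disjoint C S) :
    P'.Inside C = P.Inside C := by
  ext a b
  refine and_congr_right fun ha => and_congr_right fun hb => ?_
  exact h.2 a b (Finset.disjoint_left.1 hd ha) (Finset.disjoint_left.1 hd hb)

theorem ChangedIn.diam_eq {S : Finset α} (h : P.ChangedIn P' S) (hd : Disjoint C S) :
    P'.diam C = P.diam C := by
  simp only [diam, DiamLE, h.inside_eq hd]

/-- Together with `diam_eq`, this keeps the list of SCCs valid while the calls on its earlier
members modify the MDP in place. -/
theorem ChangedIn.stronglyConnected {S : Finset α} (h : P.ChangedIn P' S) (hd : Disjoint C S)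
    (hC : P.StronglyConnected C) : P'.StronglyConnected C := by
  refine ⟨hC.1, fun a ha => h.1 a (hC.2.1 ha) (Finset.disjoint_left.1 hd ha), ?_⟩
  change ∀ u ∈ C, ∀ v ∈ C, Relation.ReflTransGen (P'.Inside C) u v
  rw [h.inside_eq hd]
  exact hC.2.2

end SymGraph

/-! ### One round of the SCC algorithm -/

namespace Symbolic

open SymOp

variable {α : Type} [DecidableEq α]

/-- The value of `Post`. -/
def succs (P : SymGraph α) (S : Finset α) : Finset α := P.V.filter fun v => ∃ w ∈ S, (w, v) ∈ P.E

/-- The value of `Pre`. -/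
def preds (P : SymGraph α) (S : Finset α) : Finset α := P.V.filter fun v => ∃ w ∈ S, (v, w) ∈ P.E

theorem mem_succs {P : SymGraph α} {S : Finset α} {v : α} :
    v ∈ succs P S ↔ v ∈ P.V ∧ ∃ w ∈ S, (w, v) ∈ P.E := Finset.mem_filter

theorem mem_preds {P : SymGraph α} {S : Finset α} {v : α} :
    v ∈ preds P S ↔ v ∈ P.V ∧ ∃ w ∈ S, (v, w) ∈ P.E := Finset.mem_filter

/-- The edges that a forward search in `X` follows. -/
def Into (P : SymGraph α) (X : Finset α) (a b : α) : Prop := (a, b) ∈ P.E ∧ b ∈ X ∧ b ∈ P.V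

/-- The visited vertices and the current layer after `i` iterations of the forward search. -/
def fwIter (P : SymGraph α) (X N : Finset α) : ℕ → Finset α × Finset α
  | 0 => (∅, N)
  | i + 1 =>
    let s := fwIter P X N i
    (s.1 ∪ s.2, (succs P s.2 ∩ X) \ (s.1 ∪ s.2))

/-- The vertices visited in the first `i` iterations of the forward search. -/
def visited (P : SymGraph α) (X N : Finset α) (i : ℕ) : Finset α := (fwIter P X N i).1

/-- The layer of index `i` of the forward search. -/
def layer (P : SymGraph α) (X N : Finset α) (i : ℕ) : Finset α := (fwIter P X N i).2

section Forward

variable {P : SymGraph α} {X N : Finset α} {a b : α} {i j m : ℕ}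

theorem visited_succ : visited P X N (i + 1) = visited P X N i ∪ layer P X N i := rfl

theorem layer_succ :
    layer P X N (i + 1) = (succs P (layer P X N i) ∩ X) \ visited P X N (i + 1) := rfl

theorem mem_visited : a ∈ visited P X N i ↔ ∃ j < i, a ∈ layer P X N j := by
  induction i with
  | zero => simp [visited, fwIter]
  | succ i ih =>
    rw [visited_succ, Finset.mem_union, ih]
    constructor
    · rintro (⟨j, hj, h⟩ | h)
      · exact ⟨j, by omega, h⟩
      · exact ⟨i, by omega, h⟩
    · rintro ⟨j, hj, h⟩
      rcases Nat.lt_succ_iff_lt_or_eq.1 hj with hj | rfl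
      · exact Or.inl ⟨j, hj, h⟩
      · exact Or.inr h

theorem visited_mono (h : i ≤ j) : visited P X N i ⊆ visited P X N j := fun a ha => by
  obtain ⟨m, hm, ha⟩ := mem_visited.1 ha
  exact mem_visited.2 ⟨m, by omega, ha⟩

theorem not_mem_visited (h : a ∈ layer P X N i) : a ∉ visited P X N i := by
  cases i with
  | zero => simp [visited, fwIter]
  | succ i =>
    rw [layer_succ, Finset.mem_sdiff] at h
    exact h.2

theorem layer_succ_subset (h : a ∈ layer P X N (i + 1)) : a ∈ X ∧ a ∈ P.V := by
  rw [layer_succ, Finset.mem_sdiff, Finset.mem_inter, mem_succs] at h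
  exact ⟨h.1.2, h.1.1.1⟩

theorem exists_edge_of_mem_layer (h : a ∈ layer P X N (i + 1)) :
    ∃ b ∈ layer P X N i, (b, a) ∈ P.E := by
  rw [layer_succ, Finset.mem_sdiff, Finset.mem_inter, mem_succs] at h
  exact h.1.1.2

theorem visited_subset : visited P X N i ⊆ N ∪ X := fun a ha => by
  obtain ⟨m, -, ha⟩ := mem_visited.1 ha
  cases m with
  | zero => exact Finset.mem_union_left _ ha
  | succ m => exact Finset.mem_union_right _ (layer_succ_subset ha).1

theorem mem_visited_of_into (ha : a ∈ visited P X N i) (h : Into P X a b) :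
    b ∈ visited P X N (i + 1) := by
  obtain ⟨j, hj, ha⟩ := mem_visited.1 ha
  refine visited_mono (i := j + 2) (by omega) ?_
  by_cases hb : b ∈ visited P X N (j + 1)
  · exact visited_mono (by omega) hb
  · refine mem_visited.2 ⟨j + 1, by omega, ?_⟩
    rw [layer_succ, Finset.mem_sdiff, Finset.mem_inter, mem_succs]
    exact ⟨⟨⟨h.2.2, a, ha, h.1⟩, h.2.1⟩, hb⟩

/-- Layers are levels of a breadth-first search: an edge advances by at most one layer. Both the
skeleton construction and the shortest-path property of skeletons rest on this. -/
theorem le_of_walk (ha : a ∈ layer P X N i) (hb : b ∈ layer P X N j)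
    (w : Walk (Into P X) m a b) : j ≤ i + m := by
  have key : b ∈ visited P X N (i + 1 + m) := by
    clear hb
    induction w with
    | nil a => exact mem_visited.2 ⟨i, by omega, ha⟩
    | snoc _ hr ih => exact mem_visited_of_into (ih ha) hr
  by_contra hlt
  exact not_mem_visited hb (visited_mono (by omega) key)

theorem mem_visited_of_layer_eq_empty (h : layer P X N j = ∅) (ha : a ∈ visited P X N j)
    (hab : Into P X a b) : b ∈ visited P X N j := by
  have := mem_visited_of_into ha hab
  rwa [visited_succ, h, Finset.union_empty] at this

theorem le_card_visited (h : ∀ j < i, (layer P X N j).Nonempty) :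
    i ≤ (visited P X N i).card := by
  induction i with
  | zero => exact Nat.zero_le _
  | succ i ih =>
    obtain ⟨x, hx⟩ := h i (by omega)
    have h₁ := ih fun j hj => h j (by omega)
    have h₂ : (visited P X N i).card < (visited P X N (i + 1)).card :=
      Finset.card_lt_card ((Finset.ssubset_iff_of_subset (visited_mono (by omega))).2
        ⟨x, mem_visited.2 ⟨i, by omega, hx⟩, not_mem_visited hx⟩)
    omega

theorem forwardLayers_spec (P : SymGraph α) (X N : Finset α) :
    Spec (forwardLayers P X N) fun s c => ∃ j, s.FW = visited P X N j ∧
      s.stack = (List.range j).reverse.map (layer P X N) ∧ layer P X N j = ∅ ∧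
      (∀ i < j, (layer P X N i).Nonempty) ∧ c ≤ 1 + 5 * j := by
  refine (Spec.whileM (kc := 1) (kb := 4) (B := (N ∪ X).card)
    (I := fun i s => s.FW = visited P X N i ∧ s.L = layer P X N i ∧
      s.stack = (List.range i).reverse.map (layer P X N) ∧ ∀ j < i, (layer P X N j).Nonempty)
    (G := fun s => s.L.Nonempty) ?_ ?_ ?_ ?_).mono ?_
  · rintro i s ⟨-, -, -, h⟩
    exact (le_card_visited h).trans (Finset.card_le_card visited_subset)
  · rintro i s -
    refine Spec.one_bind ?_
    simp [Finset.nonempty_iff_ne_empty]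
  · rintro i s ⟨h₁, h₂, h₃, h₄⟩ hG
    iterate 4 refine Spec.one_bind ?_
    rw [Spec.pure_iff]
    refine ⟨by omega, ?_, ?_, ?_, ?_⟩
    · rw [visited_succ, h₁, h₂]
    · rw [layer_succ, visited_succ, h₁, h₂]
      rfl
    · rw [h₃, h₂, List.range_succ, List.reverse_append, List.map_append]
      rfl
    · intro j hj
      rcases Nat.lt_succ_iff_lt_or_eq.1 hj with hj | rfl
      · exact h₄ j hj
      · exact h₂ ▸ hG
  · exact ⟨rfl, rfl, rfl, fun _ h => absurd h (Nat.not_lt_zero _)⟩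
  · rintro s c ⟨j, ⟨h₁, h₂, h₃, h₄⟩, h₅, h₆⟩
    exact ⟨j, h₁, h₃, h₂ ▸ Finset.not_nonempty_iff_eq_empty.1 h₅, h₄, h₆⟩

end Forward

/-- `p 0, …, p k` is a path through the layers of the forward search. -/
structure IsLayerPath (P : SymGraph α) (X N : Finset α) (k : ℕ) (p : ℕ → α) : Prop where
  mem : ∀ i ≤ k, p i ∈ layer P X N i
  edge : ∀ i < k, (p i, p (i + 1)) ∈ P.E

/-- `Pre` is applied to the whole skeleton built so far, not only to its newest vertex. The picked
vertex nevertheless precedes the newest one, because no edge leads from layer `m` beyond layer `m +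
1`. -/
theorem skeleton_fold_spec {ch : ℕ → Finset α → α} (hch : ∀ t A, A.Nonempty → ch t A ∈ A)
    {P : SymGraph α} {X N : Finset α} (hN : N ⊆ P.V) {k : ℕ} (m : ℕ) (p : ℕ → α) (hm : m ≤ k)
    (hp : ∀ i, m ≤ i → i ≤ k → p i ∈ layer P X N i)
    (he : ∀ i, m ≤ i → i < k → (p i, p (i + 1)) ∈ P.E) :
    Spec (List.foldlM (fun sk L => do
        let y ← pick ch (← inter (← pre P sk) L)
        union sk {y}) ((Finset.Icc m k).image p) ((List.range m).reverse.map (layer P X N)))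
      fun sk c => c ≤ 4 * m ∧ ∃ p' : ℕ → α, IsLayerPath P X N k p' ∧ p' k = p k ∧
        sk = (Finset.range (k + 1)).image p' := by
  induction m generalizing p with
  | zero =>
    simp only [List.range_zero, List.reverse_nil, List.map_nil, List.foldlM_nil, Spec.pure_iff]
    refine ⟨le_rfl, p, ⟨fun i => hp i (Nat.zero_le _), fun i => he i (Nat.zero_le _)⟩, rfl, ?_⟩
    congr 1
    ext i
    simp
  | succ m ih =>
    rw [List.range_succ, List.reverse_append, List.map_append]
    simp only [List.reverse_singleton, List.map_singleton, List.singleton_append, List.foldlM_cons]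
    have hlayer : ∀ x ∈ layer P X N m, x ∈ P.V := fun x hx => by
      cases m with
      | zero => exact hN hx
      | succ m => exact (layer_succ_subset hx).2
    refine Spec.bind (R := fun sk c => c = 4 ∧ ∃ y ∈ layer P X N m, (y, p (m + 1)) ∈ P.E ∧
      sk = (Finset.Icc (m + 1) k).image p ∪ {y}) ?_ ?_
    · refine Spec.one_bind (Spec.one_bind (Spec.pick_bind hch ?_ fun y hy => ?_))
      · obtain ⟨y, hy, hyE⟩ := exists_edge_of_mem_layer (hp (m + 1) le_rfl hm)
        refine ⟨y, Finset.mem_inter.2 ⟨mem_preds.2 ⟨hlayer y hy, p (m + 1), ?_, hyE⟩, hy⟩⟩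
        exact Finset.mem_image_of_mem _ (Finset.mem_Icc.2 ⟨le_rfl, hm⟩)
      · refine Spec.one_iff.2 ⟨rfl, y, (Finset.mem_inter.1 hy).2, ?_, rfl⟩
        obtain ⟨-, z, hz, hyz⟩ := mem_preds.1 (Finset.mem_inter.1 hy).1
        obtain ⟨i, hi, rfl⟩ := Finset.mem_image.1 hz
        rw [Finset.mem_Icc] at hi
        have hpi := hp i hi.1 hi.2
        have hle : i ≤ m + 1 := by
          refine le_of_walk (Finset.mem_inter.1 hy).2 hpi (.single ⟨hyz, ?_⟩)
          obtain ⟨i, rfl⟩ : ∃ i', i = i' + 1 := ⟨i - 1, by omega⟩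
          exact layer_succ_subset hpi
        obtain rfl : i = m + 1 := by omega
        exact hyz
    · rintro sk c ⟨rfl, y, hy, hyE, rfl⟩
      have himg : (Finset.Icc (m + 1) k).image p ∪ {y} =
          (Finset.Icc m k).image (Function.update p m y) := by
        ext z
        simp only [Finset.mem_union, Finset.mem_image, Finset.mem_Icc, Finset.mem_singleton]
        constructor
        · rintro (⟨i, hi, rfl⟩ | rfl)
          · exact ⟨i, by omega, Function.update_of_ne (by omega) _ _⟩
          · exact ⟨m, by omega, Function.update_self _ _ _⟩
        · rintro ⟨i, hi, rfl⟩
          rcases eq_or_ne i m with rfl | hne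
          · exact Or.inr (Function.update_self _ _ _)
          · exact Or.inl ⟨i, by omega, (Function.update_of_ne hne _ _).symm⟩
      rw [himg]
      refine (ih (Function.update p m y) (by omega) ?_ ?_).mono ?_
      · intro i h₁ h₂
        rcases eq_or_ne i m with rfl | hne
        · rwa [Function.update_self]
        · rw [Function.update_of_ne hne]
          exact hp i (by omega) h₂
      · intro i h₁ h₂
        rw [Function.update_of_ne (by omega : i + 1 ≠ m)]
        rcases eq_or_ne i m with rfl | hne
        · rwa [Function.update_self]
        · rw [Function.update_of_ne hne]
          exact he i (by omega) h₂
      · rintro sk c ⟨hc, p', h₁, h₂, h₃⟩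
        exact ⟨by omega, p', h₁, by rw [h₂, Function.update_of_ne (by omega)], h₃⟩

theorem skelForward_spec {ch : ℕ → Finset α → α} (hch : ∀ t A, A.Nonempty → ch t A ∈ A)
    {P : SymGraph α} {X : Finset α} {v : α} (hv : v ∈ P.V) :
    Spec (skelForward ch P X {v}) fun r c => ∃ k p, IsLayerPath P X {v} k p ∧
      r.1 = visited P X {v} (k + 1) ∧ layer P X {v} (k + 1) = ∅ ∧
      r.2.1 = (Finset.range (k + 1)).image p ∧ r.2.2 = {p k} ∧ c ≤ 9 * (k + 1) := by
  refine Spec.bind (forwardLayers_spec P X {v}) ?_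
  rintro ⟨FW, L, stack⟩ c ⟨j, h₁, h₂, h₃, h₄, hc⟩
  dsimp only at h₁ h₂ ⊢
  have hj : j ≠ 0 := by
    rintro rfl
    exact absurd h₃ (Finset.singleton_ne_empty v)
  obtain ⟨k, rfl⟩ := Nat.exists_eq_succ_of_ne_zero hj
  rw [List.range_succ, List.reverse_append, List.map_append] at h₂
  simp only [List.reverse_singleton, List.map_singleton, List.singleton_append] at h₂
  subst h₂
  refine Spec.pick_bind hch (h₄ k (by omega)) fun x hx => ?_
  have := skeleton_fold_spec hch (Finset.singleton_subset_iff.2 hv) (X := X) k (fun _ => x) le_rfl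
    (fun i h₁ h₂ => by rwa [le_antisymm h₂ h₁]) (fun i h₁ h₂ => by omega)
  rw [Finset.Icc_self, Finset.image_singleton] at this
  refine Spec.bind this ?_
  rintro sk c' ⟨hc', p, hp, hpk, rfl⟩
  rw [Spec.pure_iff]
  exact ⟨k, p, hp, h₁, h₃, rfl, by rw [hpk], by omega⟩

/-- The vertices found in the first `i` iterations of the backward search. -/
def bwIter (P : SymGraph α) (FW N : Finset α) : ℕ → Finset α
  | 0 => N
  | i + 1 => bwIter P FW N i ∪ (preds P (bwIter P FW N i) ∩ FW)

/-- The number of rounds is at most the diameter of the output `C` itself, not of `FW`: a vertex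
added in the last round has a walk of length at most `d` to `v` inside `C`, so it was found after at
most `d` rounds. -/
theorem backwardIn_spec {P : SymGraph α} {FW : Finset α} {v : α} (hv : v ∈ FW) (hFW : FW ⊆ P.V) :
    Spec (backwardIn P FW {v}) fun C c => v ∈ C ∧ C ⊆ FW ∧
      (∀ a ∈ FW, ∀ b ∈ C, (a, b) ∈ P.E → a ∈ C) ∧
      (∀ u ∈ C, Relation.ReflTransGen (P.Inside C) u v) ∧
      ∀ d, P.DiamLE C d → c ≤ 4 + 7 * d := by
  have hsub : ∀ i, bwIter P FW {v} i ⊆ FW := fun i => by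
    induction i with
    | zero => exact Finset.singleton_subset_iff.2 hv
    | succ i ih => exact Finset.union_subset ih Finset.inter_subset_right
  have hmono : ∀ i, bwIter P FW {v} i ⊆ bwIter P FW {v} (i + 1) := fun i =>
    Finset.subset_union_left
  have hmono' : Monotone (bwIter P FW {v}) := monotone_nat_of_le_succ hmono
  refine (Spec.whileM (kc := 4) (kb := 3) (B := FW.card)
    (I := fun i s => s = bwIter P FW {v} i ∧ ∀ j < i,
      ∃ x ∈ bwIter P FW {v} (j + 1), x ∉ bwIter P FW {v} j)
    (G := fun s => ((preds P s ∩ FW) \ s).Nonempty) ?_ ?_ ?_ ?_).mono ?_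
  · rintro i s ⟨-, h⟩
    have : i ≤ (bwIter P FW {v} i).card := by
      induction i with
      | zero => exact Nat.zero_le _
      | succ i ih =>
        obtain ⟨x, hx, hx'⟩ := h i (by omega)
        have h₁ := ih fun j hj => h j (by omega)
        have h₂ := Finset.card_lt_card ((Finset.ssubset_iff_of_subset (hmono i)).2 ⟨x, hx, hx'⟩)
        omega
    exact this.trans (Finset.card_le_card (hsub i))
  · rintro i s -
    iterate 4 refine Spec.one_bind ?_
    rw [Spec.pure_iff]
    refine ⟨by omega, ?_⟩
    rw [Finset.nonempty_iff_ne_empty]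
    simp [preds]
  · rintro i s ⟨rfl, h⟩ ⟨x, hx⟩
    iterate 2 refine Spec.one_bind ?_
    refine Spec.one_iff.2 ⟨by omega, rfl, fun j hj => ?_⟩
    rcases Nat.lt_succ_iff_lt_or_eq.1 hj with hj | rfl
    · exact h j hj
    · rw [Finset.mem_sdiff] at hx
      exact ⟨x, Finset.mem_union_right _ hx.1, hx.2⟩
  · exact ⟨rfl, fun _ h => absurd h (Nat.not_lt_zero _)⟩
  · rintro C c ⟨j, ⟨rfl, h₁⟩, h₂, h₃⟩
    have hcl : ∀ a ∈ FW, ∀ b ∈ bwIter P FW {v} j, (a, b) ∈ P.E → a ∈ bwIter P FW {v} j := by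
      intro a ha b hb hab
      by_contra hcon
      exact h₂ ⟨a, Finset.mem_sdiff.2
        ⟨Finset.mem_inter.2 ⟨mem_preds.2 ⟨hFW ha, b, hb, hab⟩, ha⟩, hcon⟩⟩
    refine ⟨hmono' (Nat.zero_le j) (Finset.mem_singleton_self v), hsub j, hcl, ?_, ?_⟩
    · have : ∀ i ≤ j, ∀ u ∈ bwIter P FW {v} i,
          Relation.ReflTransGen (P.Inside (bwIter P FW {v} j)) u v := by
        intro i
        induction i with
        | zero =>
          intro _ u hu
          rw [Finset.mem_singleton.1 hu]
        | succ i ih =>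
          intro hi u hu
          have hu' := hmono' hi hu
          rcases Finset.mem_union.1 hu with hu | hu
          · exact ih (by omega) u hu
          · obtain ⟨-, w, hw, huw⟩ := mem_preds.1 (Finset.mem_inter.1 hu).1
            exact .head ⟨hu', hmono' (by omega : i ≤ j) hw, huw⟩ (ih (by omega) w hw)
      exact this j le_rfl
    · intro d hd
      refine h₃.trans ?_
      have : j ≤ d := by
        cases j with
        | zero => exact Nat.zero_le _
        | succ j =>
          obtain ⟨x, hx, hx'⟩ := h₁ j (by omega)
          obtain ⟨m, hm, w⟩ := hd x hx v (hmono' (Nat.zero_le _) (Finset.mem_singleton_self v))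
          have hxm : x ∈ bwIter P FW {v} m := by
            have aux : ∀ n z y, Walk (fun a b => P.Inside (bwIter P FW {v} (j + 1)) b a) n z y →
                z = v → y ∈ bwIter P FW {v} n := by
              intro n z y w
              induction w with
              | nil a => exact fun h => Finset.mem_singleton.2 h
              | @snoc n a b c w hr ih =>
                exact fun h => Finset.mem_union_right _ (Finset.mem_inter.2
                  ⟨mem_preds.2 ⟨hFW (hsub _ hr.1), b, ih h, hr.2.2⟩, hsub _ hr.1⟩)
            exact aux _ _ _ w.reverse rfl
          by_contra hcon
          exact hx' (hmono' (by omega : m ≤ j) hxm)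
      omega

/-- The result of one round of the SCC algorithm with start vertex `v`: the forward set `FW`, the
SCC `C` of `v`, and a path `p 0, …, p k` from `v` to a vertex at maximal distance. -/
structure IsRound (P : SymGraph α) (X : Finset α) (v : α) (FW C : Finset α) (k : ℕ)
    (p : ℕ → α) : Prop where
  start_mem : v ∈ C
  scc_subset : C ⊆ FW
  fw_subset : FW ⊆ insert v X
  closed : ∀ a ∈ FW, ∀ b, Into P X a b → b ∈ FW
  back : ∀ a ∈ FW, ∀ b ∈ C, (a, b) ∈ P.E → a ∈ C
  connected : P.StronglyConnected C
  path_zero : p 0 = v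
  path_mem : ∀ i ≤ k, p i ∈ FW
  edge : ∀ i < k, (p i, p (i + 1)) ∈ P.E
  dist : ∀ i ≤ k, ∀ j ≤ k, ∀ m, Walk (Into P X) m (p i) (p j) → j ≤ i + m

theorem sccRound_spec {ch : ℕ → Finset α → α} (hch : ∀ t A, A.Nonempty → ch t A ∈ A)
    {P : SymGraph α} {X : Finset α} {v : α} (hv : v ∈ P.V) :
    Spec (sccRound ch P X {v}) fun r c => ∃ k p, IsRound P X v r.1 r.2.1 k p ∧
      r.2.2.1 = (Finset.range (k + 1)).image p ∧ r.2.2.2 = {p k} ∧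
      c ≤ 9 * (k + 1) + 4 + 7 * P.diam r.2.1 := by
  refine Spec.bind (skelForward_spec hch hv) ?_
  rintro ⟨FW, newS, newN⟩ c ⟨k, p, hp, h₁, h₂, h₃, h₄, hc⟩
  dsimp only at h₁ h₃ h₄ ⊢
  subst h₁
  have hvFW : v ∈ visited P X {v} (k + 1) :=
    mem_visited.2 ⟨0, by omega, Finset.mem_singleton_self v⟩
  have hFW : visited P X {v} (k + 1) ⊆ P.V := fun a ha => by
    obtain ⟨i, -, ha⟩ := mem_visited.1 ha
    cases i with
    | zero => rwa [Finset.mem_singleton.1 ha]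
    | succ i => exact (layer_succ_subset ha).2
  refine Spec.bind (backwardIn_spec hvFW hFW) ?_
  rintro C c' ⟨hvC, hC, hback, hreach, hc'⟩
  rw [Spec.pure_iff]
  -- `C` is closed under predecessors in `FW`, so following search parents back from a vertex of `C`
  -- to `v` never leaves `C`.
  have hfw : ∀ i ≤ k, ∀ u ∈ layer P X {v} i, u ∈ C → Relation.ReflTransGen (P.Inside C) v u := by
    intro i
    induction i with
    | zero =>
      intro _ u hu _
      rw [Finset.mem_singleton.1 hu]
    | succ i ih =>
      intro hi u hu huC
      obtain ⟨w, hw, hwu⟩ := exists_edge_of_mem_layer hu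
      have hwC := hback w (mem_visited.2 ⟨i, by omega, hw⟩) u huC hwu
      exact .tail (ih (by omega) w hw hwC) ⟨hwC, huC, hwu⟩
  have hconn : P.StronglyConnected C := by
    refine ⟨⟨v, hvC⟩, hC.trans hFW, fun u hu w hw => ?_⟩
    obtain ⟨i, hi, hwi⟩ := mem_visited.1 (hC hw)
    exact (hreach u hu).trans (hfw i (by omega) w hwi hw)
  refine ⟨k, p, ⟨hvC, hC, ?_, ?_, hback, hconn, ?_, ?_, hp.edge, ?_⟩, h₃, h₄, ?_⟩
  · intro a ha
    have := visited_subset ha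
    simpa using this
  · exact fun a ha b hab => mem_visited_of_layer_eq_empty h₂ ha hab
  · exact Finset.mem_singleton.1 (hp.mem 0 (Nat.zero_le _))
  · exact fun i hi => mem_visited.2 ⟨i, by omega, hp.mem i hi⟩
  · exact fun i hi j hj m w => le_of_walk (hp.mem i hi) (hp.mem j hj) w
  · have := hc' _ hconn.diamLE_diam
    simp only
    omega

theorem IsRound.injOn {P : SymGraph α} {X FW C : Finset α} {v : α} {k : ℕ} {p : ℕ → α}
    (h : IsRound P X v FW C k p) : Set.InjOn p (Finset.range (k + 1) : Finset ℕ) := by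
  intro i hi j hj hij
  simp only [Finset.coe_range, Set.mem_Iio] at hi hj
  have h₁ := h.dist i (by omega) j (by omega) 0 (hij ▸ .nil _)
  have h₂ := h.dist j (by omega) i (by omega) 0 (hij ▸ .nil _)
  omega

/-- The form `insert v X` matters: in `incBody` the attractor may have removed the start vertex `v`
of the second search. Nor need `X` lie in `P.V`, since earlier collapses may have deleted vertices
of it. -/
theorem sccOf_spec {ch : ℕ → Finset α → α} (hch : ∀ t A, A.Nonempty → ch t A ∈ A)
    {P : SymGraph α} {X : Finset α} {v : α} (hv : v ∈ P.V) :
    Spec (sccOf ch P X v) fun C c => v ∈ C ∧ C ⊆ insert v X ∧ c ≤ 16 * X.card + 20 := by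
  refine Spec.bind (sccRound_spec hch hv) ?_
  rintro ⟨FW, C, newS, newN⟩ c ⟨k, p, h, -, -, hc⟩
  dsimp only at h hc ⊢
  rw [Spec.pure_iff]
  refine ⟨h.start_mem, h.scc_subset.trans h.fw_subset, ?_⟩
  have h₁ : FW.card ≤ X.card + 1 :=
    (Finset.card_le_card h.fw_subset).trans (Finset.card_insert_le _ _)
  have h₂ : P.diam C ≤ FW.card :=
    h.connected.diam_le_card.trans (Finset.card_le_card h.scc_subset)
  have h₃ : k + 1 ≤ FW.card := by
    have := Finset.card_le_card_of_injOn (s := Finset.range (k + 1)) (t := FW) p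
      (fun i hi => h.path_mem i (by simpa [Nat.lt_succ_iff] using hi)) h.injOn
    simpa using this
  omega

/-! ### The SCC algorithm -/

/-- `S` is empty, or the set of the vertices of a path in `X` that is a shortest path between any
two of its vertices, with end set `N`. -/
def IsSkeleton (P : SymGraph α) (X S N : Finset α) : Prop :=
  S = ∅ ∨ ∃ (k : ℕ) (p : ℕ → α), (∀ i ≤ k, p i ∈ X) ∧ (∀ i < k, (p i, p (i + 1)) ∈ P.E) ∧
    (∀ i ≤ k, ∀ j ≤ k, ∀ m, Walk (Into P X) m (p i) (p j) → j ≤ i + m) ∧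
    S = (Finset.range (k + 1)).image p ∧ N = {p k}

theorem Into.mono {β : Type} {P : SymGraph β} {X Y : Finset β} (h : X ⊆ Y) {a b : β}
    (hab : Into P X a b) : Into P Y a b := ⟨hab.1, h hab.2.1, hab.2.2⟩

theorem _root_.SymGraph.Inside.into {β : Type} {P : SymGraph β} {C X : Finset β} (hC : C ⊆ X)
    (hV : C ⊆ P.V) {a b : β} (h : P.Inside C a b) : Into P X a b := ⟨h.2.2, hC h.2.1, hV h.2.1⟩

section Round

variable {P : SymGraph α} {X FW C : Finset α} {v : α} {k : ℕ} {p : ℕ → α}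

/-- `p i` has distance at least `i` from `v`, and a vertex of `C` has distance at most `diam C`. -/
theorem IsRound.card_inter_le (h : IsRound P X v FW C k p) (hC : C ⊆ X) :
    ((Finset.range (k + 1)).image p ∩ C).card ≤ P.diam C + 1 := by
  have hsub : (Finset.range (k + 1)).image p ∩ C ⊆ (Finset.range (P.diam C + 1)).image p := by
    intro a ha
    obtain ⟨ha, haC⟩ := Finset.mem_inter.1 ha
    obtain ⟨i, hi, rfl⟩ := Finset.mem_image.1 ha
    have hi' : i ≤ k := Nat.lt_succ_iff.1 (Finset.mem_range.1 hi)
    obtain ⟨m, hm, w⟩ := h.connected.diamLE_diam v h.start_mem (p i) haC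
    rw [← h.path_zero] at w
    have := h.dist 0 (Nat.zero_le _) i hi' m (w.mono fun _ _ e => e.into hC h.connected.2.1)
    exact Finset.mem_image_of_mem _ (Finset.mem_range.2 (by omega))
  exact (Finset.card_le_card hsub).trans (Finset.card_image_le.trans (Finset.card_range _).le)

/-- `C` is closed under predecessors in `FW`, so it cuts an initial segment off the path. The rest
is a shortest path with the old end, or empty. -/
theorem IsRound.isSkeleton_inside (h : IsRound P X v FW C k p) (hFW : FW ⊆ X) :
    IsSkeleton P (FW \ C) ((Finset.range (k + 1)).image p \ C) ({p k} \ C) := by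
  classical
  have hdown : ∀ i < k, p (i + 1) ∈ C → p i ∈ C := fun i hi hC =>
    h.back _ (h.path_mem i hi.le) _ hC (h.edge i hi)
  have hdown' : ∀ i j, i ≤ j → j ≤ k → p j ∈ C → p i ∈ C := by
    intro i j hij
    induction j, hij using Nat.le_induction with
    | base => exact fun _ h => h
    | succ j hij ih => exact fun hj hC => ih (by omega) (hdown j hj hC)
  by_cases hk : p k ∈ C
  · left
    rw [Finset.sdiff_eq_empty_iff_subset]
    intro a ha
    obtain ⟨i, hi, rfl⟩ := Finset.mem_image.1 ha
    exact hdown' i k (Nat.lt_succ_iff.1 (Finset.mem_range.1 hi)) le_rfl hk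
  · right
    have hex : ∃ i, p i ∉ C := ⟨k, hk⟩
    set j := Nat.find hex with hj
    have hjk : j ≤ k := Nat.find_min' hex hk
    have hjC : p j ∉ C := Nat.find_spec hex
    have hge : ∀ i ≤ k, j ≤ i → p i ∉ C := fun i hi hji hC => hjC (hdown' j i hji hi hC)
    refine ⟨k - j, fun i => p (i + j), fun i hi => ?_, fun i hi => ?_, fun i hi i' hi' m w => ?_,
      ?_, ?_⟩
    · exact Finset.mem_sdiff.2 ⟨h.path_mem _ (by omega), hge _ (by omega) (by omega)⟩
    · dsimp only
      rw [show i + 1 + j = i + j + 1 by omega]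
      exact h.edge _ (by omega)
    · have := h.dist _ (by omega) _ (by omega) m
        (w.mono fun _ _ => .mono (Finset.sdiff_subset.trans hFW))
      omega
    · ext a
      simp only [Finset.mem_sdiff, Finset.mem_image, Finset.mem_range]
      constructor
      · rintro ⟨⟨i, hi, rfl⟩, hC⟩
        have : j ≤ i := Nat.find_min' hex hC
        exact ⟨i - j, by omega, by rw [Nat.sub_add_cancel this]⟩
      · rintro ⟨i, hi, rfl⟩
        exact ⟨⟨i + j, by omega, rfl⟩, hge _ (by omega) (by omega)⟩
    · dsimp only
      rw [Nat.sub_add_cancel hjk]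
      exact Finset.sdiff_eq_self_of_disjoint (Finset.disjoint_singleton_left.2 hk)

/-- The old skeleton ends at `v`. Once it enters `FW` it stays there, and from then on its vertices
reach `v` inside `FW`, so they lie in `C`. Hence `FW` and `C` cut off the same final segment. This
segment is a shortest path inside `C`, which bounds its size; what remains is a skeleton of `X \
FW`. -/
theorem IsRound.isSkeleton_outside (h : IsRound P X v FW C k p) (hFW : FW ⊆ X) (hX : X ⊆ P.V)
    {S N : Finset α} (hS : IsSkeleton P X S N) (hN : S.Nonempty → N = {v}) :
    IsSkeleton P (X \ FW) (S \ C) (preds P (C ∩ S) ∩ (S \ C)) ∧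
      (S ∩ C).card ≤ P.diam C + 1 := by
  classical
  rcases hS with rfl | ⟨l, s, hmem, hedge, hdist, rfl, rfl⟩
  · exact ⟨Or.inl (Finset.empty_sdiff _), by simp⟩
  have hv : s l = v := Finset.singleton_injective
    (hN ⟨s l, Finset.mem_image_of_mem _ (Finset.mem_range.2 (by omega))⟩)
  have hup : ∀ j ≤ l, ∀ i ≤ j, s i ∈ FW → s j ∈ FW := by
    intro j
    induction j with
    | zero =>
      intro _ i hi h
      rwa [← Nat.le_zero.1 hi]
    | succ j ih =>
      intro hj i hi hs
      rcases Nat.le_succ_iff.1 hi with hi | rfl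
      · exact h.closed _ (ih (by omega) i hi hs) _
          ⟨hedge j hj, hmem _ hj, hX (hmem _ hj)⟩
      · exact hs
  have hFWC : ∀ i ≤ l, s i ∈ FW → s i ∈ C := by
    intro i hi hs
    have : ∀ d, ∀ j, i ≤ j → j + d = l → s j ∈ C := by
      intro d
      induction d with
      | zero =>
        rintro j - rfl
        exact hv ▸ h.start_mem
      | succ d ih =>
        intro j hij hj
        exact h.back _ (hup j (by omega) i hij hs) _ (ih (j + 1) (by omega) (by omega))
          (hedge j (by omega))
    exact this (l - i) i le_rfl (by omega)
  have hex : ∃ i, s i ∈ C := ⟨l, hv ▸ h.start_mem⟩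
  set j := Nat.find hex with hj
  have hjC : s j ∈ C := Nat.find_spec hex
  have hjl : j ≤ l := Nat.find_min' hex (hv ▸ h.start_mem)
  have hge : ∀ i ≤ l, j ≤ i → s i ∈ C := fun i hi hji =>
    hFWC i hi (hup i hi j hji (h.scc_subset hjC))
  have hlt : ∀ i < j, s i ∉ C := fun i hi => Nat.find_min hex hi
  have hsd : (Finset.range (l + 1)).image s \ C = (Finset.range j).image s := by
    ext a
    simp only [Finset.mem_sdiff, Finset.mem_image, Finset.mem_range]
    constructor
    · rintro ⟨⟨i, hi, rfl⟩, hC⟩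
      refine ⟨i, ?_, rfl⟩
      by_contra hcon
      exact hC (hge i (by omega) (by omega))
    · rintro ⟨i, hi, rfl⟩
      exact ⟨⟨i, by omega, rfl⟩, hlt i hi⟩
  constructor
  · rw [hsd]
    rcases Nat.eq_zero_or_pos j with hj0 | hj0
    · left
      rw [hj0]
      simp
    right
    refine ⟨j - 1, s, fun i hi => ?_, fun i hi => hedge i (by omega), fun i hi i' hi' m w => ?_,
      ?_, ?_⟩
    · exact Finset.mem_sdiff.2 ⟨hmem i (by omega),
        fun hs => hlt i (by omega) (hFWC i (by omega) hs)⟩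
    · exact hdist i (by omega) i' (by omega) m (w.mono fun _ _ => .mono Finset.sdiff_subset)
    · rw [Nat.sub_add_cancel hj0]
    · ext a
      simp only [Finset.mem_inter, mem_preds, Finset.mem_image, Finset.mem_range,
        Finset.mem_singleton]
      constructor
      -- An edge from index `i < j` to index `i' ≥ j` of a shortest path forces `i' ≤ i + 1`, so the
      -- new end set is exactly `{s (j - 1)}`.
      · rintro ⟨⟨-, b, ⟨hbC, i', hi', rfl⟩, hab⟩, i, hi, rfl⟩
        have hji' : j ≤ i' := Nat.find_min' hex hbC
        have := hdist i (by omega) i' (by omega) 1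
          (.single ⟨hab, hmem i' (by omega), hX (hmem i' (by omega))⟩)
        rw [show i = j - 1 by omega]
      · rintro rfl
        refine ⟨⟨hX (hmem _ (by omega)), s j, ⟨hjC, j, by omega, rfl⟩, ?_⟩, j - 1, by omega, rfl⟩
        have := hedge (j - 1) (by omega)
        rwa [Nat.sub_add_cancel hj0] at this
  · have hsub : (Finset.range (l + 1)).image s ∩ C ⊆
        (Finset.Icc j l).image s := by
      intro a ha
      obtain ⟨ha, haC⟩ := Finset.mem_inter.1 ha
      obtain ⟨i, hi, rfl⟩ := Finset.mem_image.1 ha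
      rw [Finset.mem_range] at hi
      exact Finset.mem_image_of_mem _
        (Finset.mem_Icc.2 ⟨Nat.find_min' hex haC, by omega⟩)
    obtain ⟨m, hm, w⟩ := h.connected.diamLE_diam (s j) hjC (s l) (hv ▸ h.start_mem)
    have hlm := hdist j hjl l le_rfl m
      (w.mono fun _ _ e => e.into (h.scc_subset.trans hFW) h.connected.2.1)
    have := (Finset.card_le_card hsub).trans Finset.card_image_le
    rw [Nat.card_Icc] at this
    omega

end Round

theorem startSet_spec {ch : ℕ → Finset α → α} (hch : ∀ t A, A.Nonempty → ch t A ∈ A)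
    {P : SymGraph α} {X S N : Finset α} (hX : X.Nonempty) (hS : IsSkeleton P X S N) :
    Spec (startSet ch X S N) fun A c =>
      c ≤ 2 ∧ ∃ v ∈ X, A = {v} ∧ (S.Nonempty → N = {v}) := by
  refine Spec.one_bind ?_
  simp only [decide_eq_true_eq]
  refine Spec.ite_iff.2 ⟨fun h => ?_, fun h => ?_⟩
  · refine Spec.pick_bind hch hX fun v hv => ?_
    rw [Spec.pure_iff]
    exact ⟨le_rfl, v, hv, rfl, fun hne => absurd h hne.ne_empty⟩
  · rw [Spec.pure_iff]
    obtain ⟨k, p, hp, -, -, -, hN⟩ := hS.resolve_left h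
    exact ⟨by omega, p k, hp k le_rfl, hN, fun _ => hN⟩

/-- The members of `l` are pairwise disjoint strongly connected subsets of `X`. -/
def IsSCCList (P : SymGraph α) (X : Finset α) (l : List (Finset α)) : Prop :=
  l.Pairwise Disjoint ∧ ∀ C ∈ l, C ⊆ X ∧ P.StronglyConnected C

/-- The term `9 * S.card` is the credit stored in the skeleton. A round spends `9 * (k + 1)` on the
forward search and the new skeleton, which is exactly the credit of the new skeleton's vertices; it
is repaid when they are output. -/
theorem sccRec_spec {ch : ℕ → Finset α → α} (hch : ∀ t A, A.Nonempty → ch t A ∈ A)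
    {P : SymGraph α} (X S N : Finset α) (hX : X ⊆ P.V) (hS : IsSkeleton P X S N) :
    Spec (sccRec ch P X S N) fun l c => IsSCCList P X l ∧
      c + 9 * S.card ≤ 1 + 34 * (l.map fun C => P.diam C + 1).sum := by
  induction hd : X.card using Nat.strong_induction_on generalizing X S N with
  | _ d ih =>
  subst hd
  rw [sccRec]
  refine Spec.one_bind ?_
  simp only [decide_eq_true_eq]
  refine Spec.ite_iff.2 ⟨fun h => ?_, fun h => ?_⟩
  · subst h
    rw [Spec.pure_iff]
    refine ⟨⟨.nil, by simp⟩, ?_⟩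
    rcases hS with rfl | ⟨k, p, hp, -⟩
    · simp
    · exact absurd (hp 0 (Nat.zero_le _)) (Finset.notMem_empty _)
  refine Spec.bind (startSet_spec hch (Finset.nonempty_iff_ne_empty.2 h) hS) ?_
  rintro _ c₁ ⟨hc₁, v, hvX, rfl, hN⟩
  refine Spec.bind (sccRound_spec hch (hX hvX)) ?_
  rintro ⟨FW, C, newS, newN⟩ c₂ ⟨k, p, hr, hnewS, hnewN, hc₂⟩
  dsimp only at hr hnewS hnewN hc₂ ⊢
  subst hnewS hnewN
  have hFW : FW ⊆ X := hr.fw_subset.trans (Finset.insert_subset hvX subset_rfl)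
  have hCX := hr.scc_subset.trans hFW
  obtain ⟨hS₁, hSC⟩ := hr.isSkeleton_outside hFW hX hS hN
  have hnewC := hr.card_inter_le hCX
  have hcard : ((Finset.range (k + 1)).image p).card = k + 1 := by
    rw [Finset.card_image_of_injOn hr.injOn, Finset.card_range]
  iterate 5 refine Spec.one_bind ?_
  refine Spec.bind (ih _ ?_ (X \ FW) _ _ (Finset.sdiff_subset.trans hX) hS₁ rfl) ?_
  · exact Finset.card_lt_card ((Finset.ssubset_iff_of_subset Finset.sdiff_subset).2
      ⟨v, hvX, fun hv => (Finset.mem_sdiff.1 hv).2 (hr.scc_subset hr.start_mem)⟩)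
  rintro l₁ c₃ ⟨⟨hl₁, hl₁'⟩, hc₃⟩
  iterate 3 refine Spec.one_bind ?_
  refine Spec.bind (ih _ ?_ (FW \ C) _ _ ((Finset.sdiff_subset.trans hFW).trans hX)
    (hr.isSkeleton_inside hFW) rfl) ?_
  · exact Finset.card_lt_card ((Finset.ssubset_iff_of_subset (Finset.sdiff_subset.trans hFW)).2
      ⟨v, hvX, fun hv => (Finset.mem_sdiff.1 hv).2 hr.start_mem⟩)
  rintro l₂ c₄ ⟨⟨hl₂, hl₂'⟩, hc₄⟩
  rw [Spec.pure_iff]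
  refine ⟨⟨?_, ?_⟩, ?_⟩
  · rw [List.pairwise_cons, List.pairwise_append]
    refine ⟨fun D hD => ?_, hl₁, hl₂, fun D hD D' hD' => ?_⟩
    · rcases List.mem_append.1 hD with hD | hD
      · exact Finset.disjoint_of_subset_left hr.scc_subset
          (Finset.disjoint_of_subset_right (hl₁' D hD).1 Finset.disjoint_sdiff)
      · exact Finset.disjoint_of_subset_right (hl₂' D hD).1 Finset.disjoint_sdiff
    · exact Finset.disjoint_of_subset_left (hl₁' D hD).1
        (Finset.disjoint_of_subset_right ((hl₂' D' hD').1.trans Finset.sdiff_subset)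
          Finset.sdiff_disjoint)
  · intro D hD
    rcases List.mem_cons.1 hD with rfl | hD
    · exact ⟨hCX, hr.connected⟩
    · rcases List.mem_append.1 hD with hD | hD
      · exact ⟨(hl₁' D hD).1.trans Finset.sdiff_subset, (hl₁' D hD).2⟩
      · exact ⟨((hl₂' D hD).1.trans Finset.sdiff_subset).trans hFW, (hl₂' D hD).2⟩
  · simp only [List.map_cons, List.sum_cons, List.map_append, List.sum_append]
    -- Vertices of the old and of the new skeleton in `C` cost `9 * (diam C + 1)` each way, and the
    -- backward search with the remaining operations at most `16 * (diam C + 1)`: this gives 34.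
    have e₁ := Finset.card_sdiff_add_card_inter S C
    have e₂ := Finset.card_sdiff_add_card_inter ((Finset.range (k + 1)).image p) C
    omega

theorem sccFind_spec {ch : ℕ → Finset α → α} (hch : ∀ t A, A.Nonempty → ch t A ∈ A)
    {P : SymGraph α} {X : Finset α} (hX : X ⊆ P.V) :
    Spec (sccFind ch P X) fun l c => IsSCCList P X l ∧
      c ≤ 1 + 34 * (l.map fun C => P.diam C + 1).sum :=
  (sccRec_spec hch X ∅ ∅ hX (Or.inl rfl)).mono fun _ _ h => by simpa using h

/-! ### Random attractors, collapsing, and the incremental detection of ECs -/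

theorem restrict_spec (P : SymGraph α) (X : Finset α) :
    Spec (restrict P X) fun P' c => P'.V = X ∧ c = 4 := by
  iterate 4 refine Spec.one_bind ?_
  rw [Spec.pure_iff]
  exact ⟨rfl, rfl⟩

/-- The value of `ROut`. -/
def rOutSet (P : SymGraph α) (S : Finset α) : Finset α := preds P (P.V \ S) ∩ (S ∩ P.VR)

theorem rOut_spec (P : SymGraph α) (S : Finset α) :
    Spec (rOut P S) fun A c => A = rOutSet P S ∧ c = 4 := by
  iterate 3 refine Spec.one_bind ?_
  exact Spec.one_iff.2 ⟨rfl, rfl⟩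

theorem rOutSet_subset (P : SymGraph α) (S : Finset α) : rOutSet P S ⊆ S :=
  Finset.inter_subset_right.trans Finset.inter_subset_left

theorem attrStep_spec (P : SymGraph α) (A : Finset α) :
    Spec (attrStep P A) fun A' c => A ⊆ A' ∧ A' ⊆ A ∪ P.V ∧ c = 6 := by
  iterate 5 refine Spec.one_bind ?_
  refine Spec.one_iff.2 ⟨Finset.subset_union_left, ?_, rfl⟩
  exact Finset.union_subset_union_right (Finset.sdiff_subset.trans (Finset.filter_subset _ _))

/-- Each iteration of the loop absorbs a new vertex at a price of 7, six for the step and one for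
the test. -/
theorem attr_spec (P : SymGraph α) (T : Finset α) :
    Spec (attr P T) fun A c => T ⊆ A ∧ A ⊆ T ∪ P.V ∧ c + 7 * T.card ≤ 7 + 7 * A.card := by
  refine Spec.bind (attrStep_spec P T) ?_
  rintro A₁ c₁ ⟨h₁, h₂, rfl⟩
  refine Spec.bind (Spec.whileM (kc := 1) (kb := 6) (B := (T ∪ P.V).card)
    (I := fun i s => T ⊆ s.1 ∧ s.1 ⊆ s.2 ∧ s.2 ⊆ T ∪ P.V ∧ T.card + i ≤ s.1.card)
    (G := fun s => s.1 ≠ s.2) ?_ ?_ ?_ ?_) ?_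
  · rintro i s ⟨-, h₂, h₃, h₄⟩
    have := Finset.card_le_card (h₂.trans h₃)
    omega
  · rintro i s -
    refine Spec.one_bind ?_
    simp
  · rintro i s ⟨h₁, h₂, h₃, h₄⟩ hG
    refine Spec.bind (attrStep_spec P s.2) ?_
    rintro A c ⟨h₅, h₆, rfl⟩
    rw [Spec.pure_iff]
    refine ⟨le_rfl, h₁.trans h₂, h₅, h₆.trans (Finset.union_subset h₃ Finset.subset_union_right),
      ?_⟩
    have := Finset.card_lt_card (h₂.ssubset_of_ne hG)
    dsimp only
    omega
  · exact ⟨subset_rfl, h₁, h₂, le_rfl⟩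
  · rintro s c ⟨j, ⟨h₃, h₄, h₅, h₆⟩, h₇, h₈⟩
    rw [Spec.pure_iff, ← not_not.1 h₇]
    refine ⟨h₃, h₄.trans h₅, ?_⟩
    omega

theorem collapseRep_spec {ch : ℕ → Finset α → α} (hch : ∀ t A, A.Nonempty → ch t A ∈ A)
    {X : Finset α} (hX : X.Nonempty) (P : SymGraph α) :
    Spec (collapseRep ch X P) fun r c => r.1 ∈ X ∧ c ≤ 5 := by
  iterate 2 refine Spec.one_bind ?_
  simp only [decide_eq_true_eq]
  refine Spec.ite_iff.2 ⟨fun _ => ?_, fun h => ?_⟩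
  · refine Spec.pick_bind hch hX fun v hv => ?_
    iterate 2 refine Spec.one_bind ?_
    rw [Spec.pure_iff]
    exact ⟨hv, le_rfl⟩
  · refine Spec.pick_bind hch (Finset.nonempty_iff_ne_empty.2 h) fun v hv => ?_
    rw [Spec.pure_iff]
    exact ⟨(Finset.mem_inter.1 hv).1, by omega⟩

theorem collapseEC_spec {ch : ℕ → Finset α → α} (hch : ∀ t A, A.Nonempty → ch t A ∈ A)
    {X : Finset α} (hX : X.Nonempty) (P : SymGraph α) :
    Spec (collapseEC ch X P) fun P' c => P.ChangedIn P' X ∧ c ≤ 21 := by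
  refine Spec.bind (collapseRep_spec hch hX P) ?_
  rintro ⟨v, V1, VR⟩ c ⟨hv, hc⟩
  dsimp only at hv ⊢
  iterate 16 refine Spec.one_bind ?_
  rw [Spec.pure_iff]
  refine ⟨⟨fun a ha haX => ?_, fun a b ha hb => ?_⟩, by omega⟩
  · exact Finset.mem_sdiff.2 ⟨ha, fun h => haX (Finset.mem_sdiff.1 h).1⟩
  · have hav : a ≠ v := fun h => ha (h ▸ hv)
    have hbv : b ≠ v := fun h => hb (h ▸ hv)
    simp [ha, hb, hav, hbv, hav.symm, hbv.symm]

/-- Two SCC rounds cost `2 * (16 * |S| + 20)`, the attractor `7 * |S| + 7`, and the other operations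
at most 36. The collapsed set avoids the vertices of the separator still to be added, so these
survive in the MDP. -/
theorem incBody_spec {ch : ℕ → Finset α → α} (hch : ∀ t A, A.Nonempty → ch t A ∈ A)
    {S : Finset α} {s : IncState α} (hT : s.T.Nonempty) (hTS : s.T ⊆ S) (hTV : s.T ⊆ s.P.V)
    (hM : s.M ⊆ S) :
    Spec (incBody ch S s) fun s' c => c ≤ 39 * S.card + 83 ∧ s'.T.card + 1 = s.T.card ∧
      s'.T ⊆ s.T ∧ s'.T ⊆ s'.P.V ∧ s'.M ⊆ S ∧ s.P.ChangedIn s'.P S := by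
  refine Spec.pick_bind hch hT fun v hv => ?_
  refine Spec.one_bind (Spec.one_bind ?_)
  set T := s.T \ {v} with hTdef
  have hTcard : T.card + 1 = s.T.card := by
    rw [hTdef, ← Finset.erase_eq, Finset.card_erase_add_one hv]
  have hTsub : T ⊆ s.T := Finset.sdiff_subset
  have hvT : v ∉ T := by simp [hTdef]
  refine Spec.bind (sccOf_spec hch (hTV hv)) ?_
  rintro S' c₁ ⟨-, hS', hc₁⟩
  have hvST : v ∈ S \ T := Finset.mem_sdiff.2 ⟨hTS hv, hvT⟩
  replace hS' : S' ⊆ S \ T := hS'.trans (Finset.insert_subset hvST subset_rfl)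
  have hST : (S \ T).card ≤ S.card := Finset.card_le_card Finset.sdiff_subset
  have hS'c : S'.card ≤ S.card := (Finset.card_le_card hS').trans hST
  refine Spec.one_bind (Spec.ite_iff.2 ⟨fun _ => ?_, fun _ => ?_⟩)
  · rw [Spec.pure_iff]
    exact ⟨by omega, hTcard, hTsub, hTsub.trans hTV, hM, .refl _ _⟩
  refine Spec.bind (restrict_spec _ _) ?_
  rintro P' c₂ ⟨hP', rfl⟩
  refine Spec.bind (rOut_spec _ _) ?_
  rintro _ c₃ ⟨rfl, rfl⟩
  refine Spec.bind (attr_spec _ _) ?_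
  rintro Z c₄ ⟨-, hZ, hc₄⟩
  rw [hP', Finset.union_eq_right.2 (rOutSet_subset _ _)] at hZ
  have hZc : Z.card ≤ S.card := (Finset.card_le_card hZ).trans hS'c
  refine Spec.one_bind (Spec.one_bind ?_)
  simp only [decide_eq_true_eq]
  refine Spec.ite_iff.2 ⟨fun _ => ?_, fun _ => ?_⟩
  · rw [Spec.pure_iff]
    exact ⟨by omega, hTcard, hTsub, hTsub.trans hTV, hM, .refl _ _⟩
  refine Spec.bind (sccOf_spec hch (hTV hv)) ?_
  rintro U c₅ ⟨hvU, hU, hc₅⟩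
  have hUS : U ⊆ S \ T := hU.trans
    (Finset.insert_subset hvST (Finset.sdiff_subset.trans hS'))
  have hSZ : (S' \ Z).card ≤ S.card := (Finset.card_le_card Finset.sdiff_subset).trans hS'c
  refine Spec.bind (collapseEC_spec hch ⟨v, hvU⟩ _) ?_
  rintro P₁ c₆ ⟨hP₁, hc₆⟩
  refine Spec.one_bind ?_
  rw [Spec.pure_iff]
  refine ⟨by omega, hTcard, hTsub, fun a ha => ?_, ?_, hP₁.mono (hUS.trans Finset.sdiff_subset)⟩
  · exact hP₁.1 a (hTV (hTsub ha)) fun haU => (Finset.mem_sdiff.1 (hUS haU)).2 ha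
  · exact Finset.union_subset hM (hUS.trans Finset.sdiff_subset)

theorem incDetect_spec {ch : ℕ → Finset α → α} (hch : ∀ t A, A.Nonempty → ch t A ∈ A)
    {S T M : Finset α} {P : SymGraph α} (hTS : T ⊆ S) (hTV : T ⊆ P.V) (hM : M ⊆ S) :
    Spec (incDetect ch S T M P) fun r c => r.1 ⊆ S ∧ P.ChangedIn r.2 S ∧
      c ≤ 1 + (39 * S.card + 84) * T.card := by
  refine Spec.bind (Spec.whileM (kc := 1) (kb := 39 * S.card + 83) (B := T.card)
    (I := fun i s => s.T.card + i = T.card ∧ s.T ⊆ T ∧ s.T ⊆ s.P.V ∧ s.M ⊆ S ∧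
      P.ChangedIn s.P S) (G := fun s => s.T.Nonempty) ?_ ?_ ?_ ?_) ?_
  · rintro i s ⟨h, -⟩
    omega
  · rintro i s -
    refine Spec.one_bind ?_
    simp [Finset.nonempty_iff_ne_empty]
  · rintro i s ⟨h₁, h₂, h₃, h₄, h₅⟩ hG
    refine (incBody_spec hch hG (h₂.trans hTS) h₃ h₄).mono ?_
    rintro s' c ⟨hc, h₁', h₂', h₃', h₄', h₅'⟩
    exact ⟨hc, by omega, h₂'.trans h₂, h₃', h₄', h₅.trans h₅'⟩
  · exact ⟨rfl, subset_rfl, hTV, hM, .refl _ _⟩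
  · rintro s c ⟨j, ⟨h₁, -, -, h₄, h₅⟩, -, hc⟩
    rw [Spec.pure_iff]
    refine ⟨h₄, h₅, ?_⟩
    have : (1 + (39 * S.card + 83)) * j ≤ (39 * S.card + 84) * T.card :=
      Nat.mul_le_mul (by omega) (by omega)
    omega

end Symbolic

/-! ### Separators -/

/-! ### Growth of sums of layer sizes. -/

section Growth

/-- Bernoulli's inequality. -/
theorem two_rpow_inv_le {q : ℕ} (hq : 1 ≤ q) : (2 : ℝ) ^ (1 / (q : ℝ)) ≤ 1 + 1 / q := by
  have hq' : (0 : ℝ) < q := by exact_mod_cast hq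
  have h : (2 : ℝ) ≤ (1 + 1 / q) ^ q := by
    have := one_add_mul_le_pow (a := 1 / (q : ℝ))
      (le_trans (by norm_num) (by positivity : (0 : ℝ) ≤ _)) q
    have e : (q : ℝ) * (1 / q) = 1 := by field_simp
    linarith
  calc (2 : ℝ) ^ (1 / (q : ℝ)) ≤ ((1 + 1 / (q : ℝ)) ^ q) ^ (1 / (q : ℝ)) :=
        Real.rpow_le_rpow (by norm_num) h (by positivity)
    _ = 1 + 1 / q := by
        rw [one_div (q : ℝ), Real.pow_rpow_inv_natCast (by positivity) (by omega)]

/-- A sequence that exceeds `2 ^ (j / q - 1)` from index `q` on has partial sums at least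
`q * 2 ^ (i / q - 1)`. -/
theorem growth_le_sum {z : ℕ → ℕ} {q i : ℕ} (hq : 1 ≤ q) (h₁ : ∀ j < i, 1 ≤ z j)
    (h₂ : ∀ j < i, q ≤ j → (2 : ℝ) ^ ((j : ℝ) / q - 1) < z j) (hi : q ≤ i) :
    (q : ℝ) * 2 ^ ((i : ℝ) / q - 1) ≤ ∑ j ∈ Finset.range i, (z j : ℝ) ∧
      (q < i → (q : ℝ) * 2 ^ ((i : ℝ) / q - 1) < ∑ j ∈ Finset.range i, (z j : ℝ)) := by
  have hq' : (0 : ℝ) < q := by exact_mod_cast hq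
  induction i, hi using Nat.le_induction with
  | base =>
    refine ⟨?_, fun h => absurd h (lt_irrefl _)⟩
    rw [div_self hq'.ne', sub_self, Real.rpow_zero, mul_one]
    calc (q : ℝ) = ∑ j ∈ Finset.range q, (1 : ℝ) := by simp
      _ ≤ _ := Finset.sum_le_sum fun j hj => by exact_mod_cast h₁ j (Finset.mem_range.1 hj)
  | succ i hi ih =>
    have ih := (ih (fun j hj => h₁ j (by omega)) fun j hj => h₂ j (by omega)).1
    have hz := h₂ i (by omega) hi
    -- With `x = 2 ^ (i / q - 1)`, the sum rises from at least `q * x` by more than `x`, hence above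
    -- `q * x * (1 + 1 / q) ≥ q * x * 2 ^ (1 / q)`.
    have hlt : (q : ℝ) * 2 ^ (((i + 1 : ℕ) : ℝ) / q - 1) <
        ∑ j ∈ Finset.range (i + 1), (z j : ℝ) := by
      rw [Finset.sum_range_succ]
      have e : (2 : ℝ) ^ (((i + 1 : ℕ) : ℝ) / q - 1) =
          2 ^ ((i : ℝ) / q - 1) * 2 ^ (1 / (q : ℝ)) := by
        rw [← Real.rpow_add (by norm_num)]
        congr 1
        push_cast
        ring
      have hpos : (0 : ℝ) < 2 ^ ((i : ℝ) / q - 1) := Real.rpow_pos_of_pos (by norm_num) _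
      have := mul_le_mul_of_nonneg_left (two_rpow_inv_le hq) (mul_pos hq' hpos).le
      have e' : (q : ℝ) * 2 ^ ((i : ℝ) / q - 1) * (1 + 1 / q) =
          q * 2 ^ ((i : ℝ) / q - 1) + 2 ^ ((i : ℝ) / q - 1) := by
        field_simp
      rw [e, ← mul_assoc]
      linarith
    exact ⟨hlt.le, fun _ => hlt⟩

/-- The version of `growth_le_sum` for a sequence that is read backwards from index `γ`. -/
theorem growth_le_sum_reverse {z : ℕ → ℕ} {q γ u : ℕ} (hq : 1 ≤ q) (h₁ : ∀ j < γ, 1 ≤ z j)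
    (hu : q ≤ u + 1) (huγ : u ≤ γ)
    (h₂ : ∀ j, γ - u ≤ j → j < γ → j + q ≤ γ → (2 : ℝ) ^ (((γ : ℝ) - j) / q - 1) < z j) :
    (q : ℝ) * 2 ^ (((u + 1 : ℕ) : ℝ) / q - 1) ≤ 1 + ∑ j ∈ Finset.Ico (γ - u) γ, (z j : ℝ) ∧
      (q < u + 1 → (q : ℝ) * 2 ^ (((u + 1 : ℕ) : ℝ) / q - 1) <
        1 + ∑ j ∈ Finset.Ico (γ - u) γ, (z j : ℝ)) := by
  -- Index 0 of the reversed sequence has no layer; the value 1 there accounts for the summand 1 in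
  -- the conclusion.
  set y : ℕ → ℕ := fun u => if u = 0 then 1 else z (γ - u) with hy
  have hsum : ∀ v ≤ γ, ∑ j ∈ Finset.range (v + 1), (y j : ℝ) =
      1 + ∑ j ∈ Finset.Ico (γ - v) γ, (z j : ℝ) := by
    intro v
    induction v with
    | zero => simp [hy]
    | succ v ih =>
      intro hv
      rw [Finset.sum_range_succ, ih (by omega),
        Finset.sum_eq_sum_Ico_succ_bot (show γ - (v + 1) < γ by omega),
        show γ - (v + 1) + 1 = γ - v by omega]
      simp only [hy, Nat.add_eq_zero_iff, one_ne_zero, and_false, if_false]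
      ring
  rw [← hsum u huγ]
  refine growth_le_sum hq (fun j hj => ?_) (fun j hj hqj => ?_) hu
  · simp only [hy]
    split_ifs
    · exact le_rfl
    · exact h₁ _ (by omega)
  · simp only [hy]
    rw [if_neg (by omega)]
    have := h₂ (γ - j) (by omega) (by omega) (by omega)
    rwa [Nat.cast_sub (by omega), sub_sub_cancel] at this

variable {z : ℕ → ℕ} {q γ k : ℕ}

/-- Shows that `L` has been set whenever the search counts fewer than half of the vertices in its
first half. -/
theorem half_le_of_forall_large (hq : 1 ≤ q) (h₁ : ∀ j < γ, 1 ≤ z j) (hγ : 2 * q ≤ γ)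
    (hk : ∀ x : ℝ, (γ : ℝ) / 2 ≤ x → (k : ℝ) / 2 ≤ 2 ^ (x / q - 1))
    (h₂ : ∀ j, q ≤ j → 2 * j ≤ γ → (2 : ℝ) ^ ((j : ℝ) / q - 1) < z j) :
    (k : ℝ) / 2 ≤ ∑ j ∈ Finset.range (γ / 2 + 1), (z j : ℝ) := by
  have h := (growth_le_sum (i := γ / 2 + 1) hq (fun j hj => h₁ j (by omega))
    (fun j hj hqj => h₂ j hqj (by omega)) (by omega)).1
  have hx := hk ((γ / 2 + 1 : ℕ) : ℝ) (by
    have : (γ : ℝ) ≤ ((2 * (γ / 2 + 1) : ℕ) : ℝ) := by exact_mod_cast (by omega)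
    push_cast at this ⊢
    linarith)
  have hq' : (1 : ℝ) ≤ q := by exact_mod_cast hq
  have hpos : (0 : ℝ) ≤ 2 ^ (((γ / 2 + 1 : ℕ) : ℝ) / q - 1) :=
    (Real.rpow_pos_of_pos (by norm_num) _).le
  nlinarith

/-- Otherwise the layers after the middle, with the extra 1, contribute strictly more than `k / 2`;
together with the first half this exceeds `k`. -/
theorem not_forall_large_reverse (hq : 1 ≤ q) (h₁ : ∀ j < γ, 1 ≤ z j) (hγ : 2 * q ≤ γ)
    (hk : ∀ x : ℝ, (γ : ℝ) / 2 ≤ x → (k : ℝ) / 2 ≤ 2 ^ (x / q - 1))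
    (hsum : 1 + ∑ j ∈ Finset.range γ, z j ≤ k)
    (hc : (k : ℝ) / 2 ≤ ∑ j ∈ Finset.range (γ / 2 + 1), (z j : ℝ)) :
    ¬ ∀ j < γ, γ ≤ 2 * j → j + q ≤ γ → (2 : ℝ) ^ (((γ : ℝ) - j) / q - 1) < z j := by
  intro h₂
  have hq' : (1 : ℝ) ≤ q := by exact_mod_cast hq
  obtain ⟨u, hu⟩ : ∃ u, u = (γ - 1) / 2 := ⟨_, rfl⟩
  have h := growth_le_sum_reverse (u := u) hq h₁ (by omega) (by omega)
    (fun j hj hjγ hjq => h₂ j hjγ (by omega) hjq)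
  -- Strictness fails only if `γ = 2 * q`. Then `k ≤ 2`, although the root and `γ ≥ 2` non-empty
  -- layers need at least 3 vertices.
  have hqu : q < u + 1 := by
    by_contra hcon
    have hγq : γ = 2 * q := by omega
    have hk2 := hk q (by rw [hγq]; push_cast; linarith)
    rw [div_self (by linarith), sub_self, Real.rpow_zero] at hk2
    have : k ≤ 2 := by
      have : (k : ℝ) ≤ 2 := by linarith
      exact_mod_cast this
    have : γ ≤ ∑ j ∈ Finset.range γ, z j := by
      calc γ = ∑ j ∈ Finset.range γ, 1 := by simp
        _ ≤ _ := Finset.sum_le_sum fun j hj => h₁ j (Finset.mem_range.1 hj)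
    omega
  have h := h.2 hqu
  have hx := hk ((u + 1 : ℕ) : ℝ) (by
    have : (γ : ℝ) ≤ ((2 * (u + 1) : ℕ) : ℝ) := by exact_mod_cast (by omega)
    push_cast at this ⊢
    linarith)
  have hpos : (0 : ℝ) ≤ 2 ^ (((u + 1 : ℕ) : ℝ) / q - 1) :=
    (Real.rpow_pos_of_pos (by norm_num) _).le
  have hsum' : (1 : ℝ) + ∑ j ∈ Finset.range γ, (z j : ℝ) ≤ k := by exact_mod_cast hsum
  rw [← Finset.sum_range_add_sum_Ico _ (by omega : γ / 2 + 1 ≤ γ),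
    show γ / 2 + 1 = γ - u by omega] at hsum'
  rw [show γ / 2 + 1 = γ - u by omega] at hc
  nlinarith

end Growth

/-! ### Arithmetic of the quality. -/

theorem Symbolic.two_le_of_quality_pos {γ k : ℕ} (h : 1 ≤ quality γ k) : 2 ≤ k := by
  by_contra hk
  have : k = 0 ∨ k = 1 := by omega
  -- For `k ≤ 1` the logarithm is 0 by convention or value, and division by zero makes the quality
  -- 0.
  rcases this with rfl | rfl <;> simp [quality] at h

theorem Symbolic.quality_mul_log_le {γ k : ℕ} (h : 1 ≤ quality γ k) :
    (quality γ k : ℝ) * Real.logb 2 k ≤ γ / 2 := by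
  have hk := two_le_of_quality_pos h
  have hlog : 0 < Real.logb 2 k := Real.logb_pos (by norm_num) (by exact_mod_cast hk)
  have := Nat.floor_le (a := (γ : ℝ) / (2 * Real.logb 2 k)) (by positivity)
  rw [le_div_iff₀ (by positivity)] at this
  unfold quality
  linarith

theorem Symbolic.two_mul_quality_le {γ k : ℕ} (h : 1 ≤ quality γ k) : 2 * quality γ k ≤ γ := by
  have h₁ := quality_mul_log_le h
  have h₂ : (1 : ℝ) ≤ Real.logb 2 k := by
    rw [Real.le_logb_iff_rpow_le (by norm_num) (by have := two_le_of_quality_pos h; positivity),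
      Real.rpow_one]
    exact_mod_cast two_le_of_quality_pos h
  have h₃ : (2 * quality γ k : ℝ) ≤ γ := by
    have : (0 : ℝ) ≤ quality γ k := Nat.cast_nonneg _
    nlinarith
  exact_mod_cast h₃

theorem Symbolic.half_le_two_rpow {γ k : ℕ} (h : 1 ≤ quality γ k) {x : ℝ} (hx : (γ : ℝ) / 2 ≤ x) :
    (k : ℝ) / 2 ≤ 2 ^ (x / quality γ k - 1) := by
  have hk := two_le_of_quality_pos h
  have hq : (0 : ℝ) < quality γ k := by exact_mod_cast h
  have h₁ : Real.logb 2 k ≤ x / quality γ k := by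
    rw [le_div_iff₀ hq]
    have := quality_mul_log_le h
    linarith
  rw [Real.rpow_sub_one (by norm_num)]
  have h₂ : (k : ℝ) = 2 ^ Real.logb 2 k :=
    (Real.rpow_logb (by norm_num) (by norm_num) (by exact_mod_cast (by omega : 0 < k))).symm
  have h₃ := Real.rpow_le_rpow_of_exponent_le (x := 2) (by norm_num) h₁
  rw [← h₂] at h₃
  linarith

/-- Allows one fixed `q`, that of the whole MDP, in the cost bound of all recursive calls. -/
theorem Symbolic.quality_anti {γ k n : ℕ} (hk : 2 ≤ k) (hkn : k ≤ n) :
    quality γ n ≤ quality γ k := by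
  have hlog : 0 < Real.logb 2 k := Real.logb_pos (by norm_num) (by exact_mod_cast hk)
  have hle : Real.logb 2 k ≤ Real.logb 2 n :=
    Real.logb_le_logb_of_le (by norm_num) (by positivity) (by exact_mod_cast hkn)
  unfold quality
  exact Nat.floor_le_floor (by gcongr)

namespace Symbolic

open SymOp

variable {α : Type} [DecidableEq α]

/-! ### Breadth-first search in `Separator` -/

/-- The set `K` after `i` iterations of the search, where `nx` is `Post` or `Pre`. -/
def ball (nx : Finset α → Finset α) (X : Finset α) (r : α) : ℕ → Finset α
  | 0 => {r}
  | i + 1 => ball nx X r i ∪ (nx (ball nx X r i) ∩ X)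

/-- The set `Z` of the iteration `i` of the search. -/
def sphere (nx : Finset α → Finset α) (X : Finset α) (r : α) (i : ℕ) : Finset α :=
  (nx (ball nx X r i) \ ball nx X r i) ∩ X

section Ball

variable {nx : Finset α → Finset α} {X : Finset α} {r : α}

theorem ball_mono : Monotone (ball nx X r) :=
  monotone_nat_of_le_succ fun _ => Finset.subset_union_left

theorem ball_subset (hr : r ∈ X) (i : ℕ) : ball nx X r i ⊆ X := by
  induction i with
  | zero => exact Finset.singleton_subset_iff.2 hr
  | succ i ih => exact Finset.union_subset ih Finset.inter_subset_right

theorem ball_succ_eq (i : ℕ) : ball nx X r (i + 1) = ball nx X r i ∪ sphere nx X r i := by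
  ext a
  simp only [ball, sphere, Finset.mem_union, Finset.mem_inter, Finset.mem_sdiff]
  tauto

theorem disjoint_ball_sphere (i : ℕ) : Disjoint (ball nx X r i) (sphere nx X r i) :=
  Finset.disjoint_left.2 fun _ ha ha' =>
    (Finset.mem_sdiff.1 (Finset.mem_inter.1 ha').1).2 ha

theorem card_ball_succ (i : ℕ) :
    (ball nx X r (i + 1)).card = (ball nx X r i).card + (sphere nx X r i).card := by
  rw [ball_succ_eq, Finset.card_union_of_disjoint (disjoint_ball_sphere i)]

theorem card_ball (i : ℕ) :
    (ball nx X r i).card = 1 + ∑ j ∈ Finset.range i, (sphere nx X r j).card := by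
  induction i with
  | zero => rfl
  | succ i ih => rw [card_ball_succ, ih, Finset.sum_range_succ, Nat.add_assoc]

end Ball

theorem exists_walk_of_mem_ball_succs {P : SymGraph α} {X : Finset α} {r : α} (hr : r ∈ X)
    (i : ℕ) : ∀ a ∈ ball (succs P) X r i, ∃ m ≤ i, Walk (P.Inside X) m r a := by
  induction i with
  | zero =>
    intro a ha
    rw [Finset.mem_singleton.1 ha]
    exact ⟨0, le_rfl, .nil r⟩
  | succ i ih =>
    intro a ha
    rcases Finset.mem_union.1 ha with ha | ha
    · obtain ⟨m, hm, w⟩ := ih a ha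
      exact ⟨m, by omega, w⟩
    · obtain ⟨ha, haX⟩ := Finset.mem_inter.1 ha
      obtain ⟨-, b, hb, hba⟩ := mem_succs.1 ha
      obtain ⟨m, hm, w⟩ := ih b hb
      exact ⟨m + 1, by omega, w.snoc ⟨ball_subset hr i hb, haX, hba⟩⟩

theorem exists_walk_of_mem_ball_preds {P : SymGraph α} {X : Finset α} {r : α} (hr : r ∈ X)
    (i : ℕ) : ∀ a ∈ ball (preds P) X r i, ∃ m ≤ i, Walk (P.Inside X) m a r := by
  induction i with
  | zero =>
    intro a ha
    rw [Finset.mem_singleton.1 ha]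
    exact ⟨0, le_rfl, .nil r⟩
  | succ i ih =>
    intro a ha
    rcases Finset.mem_union.1 ha with ha | ha
    · obtain ⟨m, hm, w⟩ := ih a ha
      exact ⟨m, by omega, w⟩
    · obtain ⟨ha, haX⟩ := Finset.mem_inter.1 ha
      obtain ⟨-, b, hb, hab⟩ := mem_preds.1 ha
      obtain ⟨m, hm, w⟩ := ih b hb
      exact ⟨m + 1, by omega, .cons ⟨haX, ball_subset hr i hb, hab⟩ w⟩

/-- In a strongly connected set, a search that has not found all vertices finds a new one. -/
def Expands (P : SymGraph α) (nx : Finset α → Finset α) : Prop :=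
  ∀ C K : Finset α, P.StronglyConnected C → ∀ u ∈ C, u ∈ K → ∀ v ∈ C, v ∉ K →
    ∃ x ∈ C, x ∈ nx K ∧ x ∉ K

theorem expands_succs (P : SymGraph α) : Expands P (succs P) := by
  intro C K hC u hu huK v hv hvK
  obtain ⟨a, b, hab, ha, hb⟩ := hC.exists_edge_leaving hu hv huK hvK
  exact ⟨b, hab.2.1, mem_succs.2 ⟨hC.2.1 hab.2.1, a, ha, hab.2.2⟩, hb⟩

theorem expands_preds (P : SymGraph α) : Expands P (preds P) := by
  intro C K hC u hu huK v hv hvK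
  obtain ⟨a, b, hab, ha, hb⟩ := hC.exists_edge_leaving (B := C \ K) hv hu
    (Finset.mem_sdiff.2 ⟨hv, hvK⟩) fun h => (Finset.mem_sdiff.1 h).2 huK
  have hbK : b ∈ K := by
    by_contra h
    exact hb (Finset.mem_sdiff.2 ⟨hab.2.1, h⟩)
  exact ⟨a, hab.1, mem_preds.2 ⟨hC.2.1 hab.1, b, hbK, hab.2.2⟩, (Finset.mem_sdiff.1 ha).2⟩

/-! ### The invariant of the loops of `Separator` -/

section Invariant

variable (nx : Finset α → Finset α) (X : Finset α) (r : α) (γ q : ℕ)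

/-- The invariant for the variable `L` before the iteration `i`. -/
def LInv (i : ℕ) (L : Finset α) : Prop :=
  (L = ∅ ∧ ∀ j < i, q ≤ j → 2 * j ≤ γ →
    (2 : ℝ) ^ ((j : ℝ) / q - 1) < (sphere nx X r j).card) ∨
  ∃ j < i, q ≤ j ∧ 2 * j ≤ γ ∧ L = sphere nx X r j ∧
    ((sphere nx X r j).card : ℝ) ≤ (2 : ℝ) ^ ((j : ℝ) / q - 1) ∧
    ∀ j' < j, q ≤ j' → (2 : ℝ) ^ ((j' : ℝ) / q - 1) < (sphere nx X r j').card

/-- The invariant for the variable `R` before the iteration `i`. -/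
def RInv (i : ℕ) (R : Finset α) : Prop :=
  (R = ∅ ∧ ∀ j < i, γ ≤ 2 * j → j + q ≤ γ →
    (2 : ℝ) ^ (((γ : ℝ) - j) / q - 1) < (sphere nx X r j).card) ∨
  ∃ j < i, γ ≤ 2 * j ∧ j + q ≤ γ ∧ R = sphere nx X r j ∧
    ((sphere nx X r j).card : ℝ) ≤ (2 : ℝ) ^ (((γ : ℝ) - j) / q - 1) ∧
    ∀ j', j < j' → j' < i → j' + q ≤ γ →
      (2 : ℝ) ^ (((γ : ℝ) - j') / q - 1) < (sphere nx X r j').card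

/-- The invariant of the loops of `Separator`. -/
structure SepInv (i : ℕ) (s : SepState α) : Prop where
  i_eq : s.i = i
  K_eq : s.K = ball nx X r i
  c_eq : s.c = ∑ j ∈ Finset.range i, if 2 * j ≤ γ then (sphere nx X r j).card else 0
  sphere_nonempty : ∀ j < i, (sphere nx X r j).Nonempty
  L_inv : LInv nx X r γ q i s.L
  R_inv : RInv nx X r γ q i s.R

variable {nx X r γ q}

theorem LInv.succ_of_skip {i : ℕ} {L : Finset α} (h : LInv nx X r γ q i L)
    (hL : ¬ (q ≤ i ∧ 2 * i ≤ γ)) : LInv nx X r γ q (i + 1) L := by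
  rcases h with ⟨h₁, h₂⟩ | ⟨j, hj, h⟩
  · refine Or.inl ⟨h₁, fun j hj hqj hjγ => ?_⟩
    rcases Nat.lt_succ_iff_lt_or_eq.1 hj with hj | rfl
    · exact h₂ j hj hqj hjγ
    · exact absurd ⟨hqj, hjγ⟩ hL
  · exact Or.inr ⟨j, by omega, h⟩

/-- The algorithm reads `L = ∅` as "not yet set". This is sound because every layer found so far is
non-empty, so `L` is the first small layer. -/
theorem LInv.succ_of_set {i : ℕ} {L : Finset α} (h : LInv nx X r γ q i L) (hi : q ≤ i ∧ 2 * i ≤ γ)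
    (hne : ∀ j < i, (sphere nx X r j).Nonempty) (hL : L = ∅)
    (hle : ((sphere nx X r i).card : ℝ) ≤ (2 : ℝ) ^ ((i : ℝ) / q - 1)) :
    LInv nx X r γ q (i + 1) (sphere nx X r i) := by
  rcases h with ⟨-, h₂⟩ | ⟨j, hj, -, -, h, -⟩
  · exact Or.inr ⟨i, by omega, hi.1, hi.2, rfl, hle, fun j hj hqj => h₂ j hj hqj (by omega)⟩
  · exact absurd (h.symm.trans hL) (hne j hj).ne_empty

theorem LInv.succ_of_keep {i : ℕ} {L : Finset α} (h : LInv nx X r γ q i L)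
    (hL : ¬ (L = ∅ ∧ ((sphere nx X r i).card : ℝ) ≤ (2 : ℝ) ^ ((i : ℝ) / q - 1))) :
    LInv nx X r γ q (i + 1) L := by
  rcases h with ⟨h₁, h₂⟩ | ⟨j, hj, h⟩
  · refine Or.inl ⟨h₁, fun j hj hqj hjγ => ?_⟩
    rcases Nat.lt_succ_iff_lt_or_eq.1 hj with hj | rfl
    · exact h₂ j hj hqj hjγ
    · exact not_le.1 fun h => hL ⟨h₁, h⟩
  · exact Or.inr ⟨j, by omega, h⟩

theorem RInv.succ_of_set {i : ℕ} (hi : γ ≤ 2 * i ∧ i + q ≤ γ)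
    (hle : ((sphere nx X r i).card : ℝ) ≤ (2 : ℝ) ^ (((γ : ℝ) - i) / q - 1)) :
    RInv nx X r γ q (i + 1) (sphere nx X r i) :=
  Or.inr ⟨i, by omega, hi.1, hi.2, rfl, hle, fun j' h h' => by omega⟩

theorem RInv.succ_of_keep {i : ℕ} {R : Finset α} (h : RInv nx X r γ q i R)
    (hR : γ ≤ 2 * i → i + q ≤ γ →
      ¬ ((sphere nx X r i).card : ℝ) ≤ (2 : ℝ) ^ (((γ : ℝ) - i) / q - 1)) :
    RInv nx X r γ q (i + 1) R := by
  rcases h with ⟨h₁, h₂⟩ | ⟨j, hj, h₁, h₂, h₃, h₄, h₅⟩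
  · refine Or.inl ⟨h₁, fun j hj hqj hjγ => ?_⟩
    rcases Nat.lt_succ_iff_lt_or_eq.1 hj with hj | rfl
    · exact h₂ j hj hqj hjγ
    · exact not_le.1 (hR hqj hjγ)
  · refine Or.inr ⟨j, by omega, h₁, h₂, h₃, h₄, fun j' hj' hji hq => ?_⟩
    rcases Nat.lt_succ_iff_lt_or_eq.1 hji with hji | rfl
    · exact h₅ j' hj' hji hq
    · exact not_le.1 (hR (by omega) hq)

theorem natCast_le_half_iff {i γ : ℕ} : (i : ℝ) ≤ (γ : ℝ) / 2 ↔ 2 * i ≤ γ := by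
  rw [le_div_iff₀ (by norm_num), mul_comm]
  exact_mod_cast Iff.rfl

theorem half_le_natCast_iff {i γ : ℕ} : (γ : ℝ) / 2 ≤ (i : ℝ) ↔ γ ≤ 2 * i := by
  rw [div_le_iff₀ (by norm_num), mul_comm]
  exact_mod_cast Iff.rfl

theorem natCast_le_sub_iff {i γ q : ℕ} : (i : ℝ) ≤ (γ : ℝ) - q ↔ i + q ≤ γ := by
  rw [le_sub_iff_add_le]
  exact_mod_cast Iff.rfl

theorem sepBody_spec {i : ℕ} {s : SepState α} (h : SepInv nx X r γ q i s)
    (hne : (sphere nx X r i).Nonempty) :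
    -- The 16 operations are 5 for `L`, 4 for `R`, 4 for the counter and 3 for `K`.
    Spec (sepBody (fun S => one (nx S)) X γ q s) fun s' c =>
      c ≤ 16 ∧ SepInv nx X r γ q (i + 1) s' := by
  obtain ⟨si, sK, sc, sL, sR⟩ := s
  obtain ⟨h₁, h₂, h₃, h₄, h₅, h₆⟩ := h
  dsimp only at h₁ h₂ h₃ h₅ h₆
  subst h₁ h₂ h₃
  have h₄' : ∀ j < si + 1, (sphere nx X r j).Nonempty := fun j hj => by
    rcases Nat.lt_succ_iff_lt_or_eq.1 hj with hj | rfl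
    · exact h₄ j hj
    · exact hne
  unfold sepBody
  simp only [natCast_le_half_iff, half_le_natCast_iff, natCast_le_sub_iff]
  refine Spec.ite_iff.2 ⟨fun hi => ?_, fun hi => ?_⟩
  on_goal 1 =>
    iterate 5 refine Spec.one_bind ?_
    simp only [Bool.and_eq_true, decide_eq_true_eq]
    refine Spec.ite_iff.2 ⟨fun hi' => ?_, fun hi' => ?_⟩
  on_goal 1 => have hL := h₅.succ_of_set hi h₄ hi'.1 hi'.2
  on_goal 2 => have hL := h₅.succ_of_keep hi'
  on_goal 3 => have hL := h₅.succ_of_skip hi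
  all_goals
    refine Spec.pure_bind_iff.2 ?_
    refine Spec.ite_iff.2 ⟨fun hj => ?_, fun hj => ?_⟩
    on_goal 1 =>
      iterate 4 refine Spec.one_bind ?_
      refine Spec.ite_iff.2 ⟨fun hj' => ?_, fun hj' => ?_⟩
    on_goal 1 => have hR := RInv.succ_of_set hj hj'
    on_goal 2 => have hR := h₆.succ_of_keep fun _ _ => hj'
    on_goal 3 => have hR := h₆.succ_of_keep fun h h' => absurd ⟨h, h'⟩ hj
  all_goals
    refine Spec.pure_bind_iff.2 ?_
    refine Spec.ite_iff.2 ⟨fun hk => ?_, fun hk => ?_⟩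
    on_goal 1 =>
      iterate 4 refine Spec.one_bind ?_
    all_goals
      refine Spec.pure_bind_iff.2 ?_
      iterate 3 refine Spec.one_bind ?_
      rw [Spec.pure_iff]
      refine ⟨by omega, rfl, rfl, ?_, h₄', hL, hR⟩
      rw [Finset.sum_range_succ]
      first | rw [if_pos hk]; rfl | rw [if_neg hk]; rfl

end Invariant

/-! ### The properties of the computed separator -/

/-- The non-empty set `T` separates `X` into `A` and `B`, and is small compared to the number of
pairs of vertices that it separates. -/
def IsSeparator (P : SymGraph α) (X : Finset α) (q : ℕ) (T : Finset α) : Prop :=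
  T.Nonempty ∧ T ⊆ X ∧ ∃ A B : Finset α, A.card + T.card + B.card = X.card ∧
    (∀ C ⊆ X, P.StronglyConnected C → Disjoint C T → C ⊆ A ∨ C ⊆ B) ∧
    q * T.card * X.card ≤ 2 * (A.card + T.card) * (B.card + T.card)

section Quality

variable {P : SymGraph α} {nx : Finset α → Finset α} {X : Finset α} {r : α} {γ : ℕ}

/-- A strongly connected set that meets the ball and is not contained in it must meet the sphere,
whichever direction the search takes. The product bound needs one side, with `T`, to have size at
least `q * |T|` and the other, with `T`, at least half of `X`. -/
theorem isSeparator_sphere (hnx : Expands P nx) (hr : r ∈ X) {q j : ℕ}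
    (hne : (sphere nx X r j).Nonempty)
    (h : (q * (sphere nx X r j).card ≤ (ball nx X r (j + 1)).card ∧
        X.card ≤ 2 * (X.card - (ball nx X r j).card)) ∨
      (q * (sphere nx X r j).card ≤ X.card - (ball nx X r j).card ∧
        X.card ≤ 2 * (ball nx X r (j + 1)).card)) :
    IsSeparator P X q (sphere nx X r j) := by
  refine ⟨hne, Finset.inter_subset_right, ball nx X r j, X \ ball nx X r (j + 1), ?_, ?_, ?_⟩
  · rw [← card_ball_succ, Finset.card_sdiff_of_subset (ball_subset hr _)]
    have := Finset.card_le_card (ball_subset (nx := nx) hr (j + 1))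
    omega
  · intro C hCX hC hd
    by_cases hCB : C ⊆ ball nx X r j
    · exact Or.inl hCB
    right
    obtain ⟨v, hv, hvB⟩ := Finset.not_subset.1 hCB
    have hout : ∀ u ∈ C, u ∉ ball nx X r j := by
      intro u hu huB
      obtain ⟨x, hx, hx', hxB⟩ := hnx C _ hC u hu huB v hv hvB
      exact Finset.disjoint_left.1 hd hx
        (Finset.mem_inter.2 ⟨Finset.mem_sdiff.2 ⟨hx', hxB⟩, hCX hx⟩)
    intro u hu
    refine Finset.mem_sdiff.2 ⟨hCX hu, fun h => ?_⟩
    rw [ball_succ_eq, Finset.mem_union] at h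
    exact h.elim (hout u hu) (Finset.disjoint_left.1 hd hu)
  · have h₁ := card_ball_succ (nx := nx) (X := X) (r := r) j
    have h₂ := Finset.card_le_card (ball_subset (nx := nx) hr (j + 1))
    rw [← h₁, Finset.card_sdiff_of_subset (ball_subset hr _),
      show X.card - (ball nx X r (j + 1)).card + (sphere nx X r j).card =
        X.card - (ball nx X r j).card by omega]
    rcases h with ⟨h₃, h₄⟩ | ⟨h₃, h₄⟩
    · calc q * (sphere nx X r j).card * X.card
          ≤ (ball nx X r (j + 1)).card * (2 * (X.card - (ball nx X r j).card)) :=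
            Nat.mul_le_mul h₃ h₄
        _ = _ := by ring
    · calc q * (sphere nx X r j).card * X.card
          ≤ (X.card - (ball nx X r j).card) * (2 * (ball nx X r (j + 1)).card) :=
            Nat.mul_le_mul h₃ h₄
        _ = _ := by ring

/-- `L` is the first small layer of the first half, so the large layers before it make the inner
side big enough. `R` is the last small layer of the second half, so the large layers after it do
this for the outer side. The counter tells which choice leaves half of `X` on the opposite side. -/
theorem SepInv.isSeparator (hnx : Expands P nx) (hr : r ∈ X) (hq : 1 ≤ quality γ X.card)
    {i : ℕ} {s : SepState α} (h : SepInv nx X r γ (quality γ X.card) i s) (hi : γ ≤ i) :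
    IsSeparator P X (quality γ X.card)
      (if (s.c : ℝ) < (X.card : ℝ) / 2 then s.L else s.R) := by
  set q := quality γ X.card with hqdef
  have hγ : 2 * q ≤ γ := two_mul_quality_le hq
  have hk : ∀ x : ℝ, (γ : ℝ) / 2 ≤ x → (X.card : ℝ) / 2 ≤ 2 ^ (x / q - 1) :=
    fun x hx => half_le_two_rpow hq hx
  set z : ℕ → ℕ := fun j => (sphere nx X r j).card with hz
  have hz₁ : ∀ j < i, 1 ≤ z j := fun j hj => Finset.card_pos.2 (h.sphere_nonempty j hj)
  have hz₂ : ∀ j < γ, 1 ≤ z j := fun j hj => hz₁ j (by omega)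
  have hball : ∀ j, (ball nx X r j).card = 1 + ∑ j ∈ Finset.range j, z j := card_ball
  have hballX : ∀ j, (ball nx X r j).card ≤ X.card := fun j =>
    Finset.card_le_card (ball_subset hr j)
  have hc : s.c = ∑ j ∈ Finset.range (γ / 2 + 1), z j := by
    rw [h.c_eq, ← Finset.sum_filter]
    refine Finset.sum_congr ?_ fun _ _ => rfl
    ext j
    simp only [Finset.mem_filter, Finset.mem_range]
    omega
  have hcast : ∀ t : Finset ℕ, ((∑ j ∈ t, z j : ℕ) : ℝ) = ∑ j ∈ t, (z j : ℝ) := fun t => by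
    push_cast; rfl
  have hcl : ∀ j, 2 * j ≤ γ → ∑ j ∈ Finset.range (j + 1), z j ≤ s.c := fun j hj => by
    rw [hc]
    exact Finset.sum_le_sum_of_subset (Finset.range_subset_range.2 (by omega))
  have hcr : ∀ j, γ ≤ 2 * j → s.c ≤ ∑ j ∈ Finset.range (j + 1), z j := fun j hj => by
    rw [hc]
    exact Finset.sum_le_sum_of_subset (Finset.range_subset_range.2 (by omega))
  have hq' : (0 : ℝ) ≤ q := Nat.cast_nonneg _
  split_ifs with hlt
  · rcases h.L_inv with ⟨-, hall⟩ | ⟨j, hj, hqj, hjγ, hL, hle, hgt⟩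
    · exfalso
      have := half_le_of_forall_large hq hz₂ hγ hk fun j hqj hjγ => hall j (by omega) hqj hjγ
      rw [← hcast, ← hc] at this
      linarith
    · rw [hL]
      refine isSeparator_sphere hnx hr (h.sphere_nonempty j hj) (Or.inl ⟨?_, ?_⟩)
      · have h₁ := (growth_le_sum (z := z) (i := j) hq (fun j' hj' => hz₁ j' (by omega)) hgt hqj).1
        have h₂ := mul_le_mul_of_nonneg_left hle hq'
        rw [← hcast] at h₁
        have h₃ : q * (sphere nx X r j).card ≤ ∑ j ∈ Finset.range j, z j := by
          exact_mod_cast h₂.trans h₁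
        have h₄ := hball j
        have h₅ := card_ball_succ (nx := nx) (X := X) (r := r) j
        omega
      · have h₁ := hcl j hjγ
        rw [Finset.sum_range_succ] at h₁
        have h₂ := hball j
        have h₃ : 1 ≤ z j := hz₁ j hj
        have h₄ : 2 * s.c < X.card := by
          have : 2 * (s.c : ℝ) < X.card := by linarith
          exact_mod_cast this
        omega
  · rw [not_lt] at hlt
    have hsum : 1 + ∑ j ∈ Finset.range γ, z j ≤ X.card := hball γ ▸ hballX γ
    have hlt' := hlt
    rw [hc, hcast] at hlt'
    rcases h.R_inv with ⟨-, hall⟩ | ⟨j, hj, hjγ, hqj, hR, hle, hgt⟩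
    · exact absurd (fun j hj hjγ hqj => hall j (by omega) hjγ hqj)
        (not_forall_large_reverse hq hz₂ hγ hk hsum hlt')
    · rw [hR]
      refine isSeparator_sphere hnx hr (h.sphere_nonempty j hj) (Or.inr ⟨?_, ?_⟩)
      · have h₁ := (growth_le_sum_reverse (z := z) (γ := γ) (u := γ - j - 1) hq hz₂ (by omega)
          (by omega) fun j' hj' hjγ' hq' => hgt j' (by omega) (by omega) hq').1
        have h₂ := mul_le_mul_of_nonneg_left hle hq'
        rw [← hcast, show γ - j - 1 + 1 = γ - j by omega, Nat.cast_sub (by omega),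
          show γ - (γ - j - 1) = j + 1 by omega] at h₁
        have h₃ : q * (sphere nx X r j).card ≤ 1 + ∑ j ∈ Finset.Ico (j + 1) γ, z j := by
          exact_mod_cast h₂.trans h₁
        rw [← Finset.sum_range_add_sum_Ico _ (by omega : j + 1 ≤ γ),
          Finset.sum_range_succ] at hsum
        have h₄ := hball j
        have h₅ : 1 ≤ z j := hz₁ j hj
        omega
      · have h₁ := hcr j hjγ
        have h₂ := hball (j + 1)
        have h₃ : X.card ≤ 2 * s.c := by
          have : (X.card : ℝ) ≤ 2 * s.c := by linarith
          exact_mod_cast this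
        omega

end Quality

theorem sepSearch_spec {nx : Finset α → Finset α} {X : Finset α} {r : α} {γ q : ℕ} (hr : r ∈ X)
    {cond : SepState α → SymM Bool} {G : SepState α → Prop}
    (hc : ∀ s, Spec (cond s) fun b c => c ≤ 3 ∧ (b = true ↔ G s))
    (hG : ∀ s, G s → ¬ nx s.K ∩ X ⊆ s.K) :
    Spec (whileM cond (sepBody (fun S => one (nx S)) X γ q) ⟨0, {r}, 0, ∅, ∅⟩) fun s c =>
      SepInv nx X r γ q s.i s ∧ ¬ G s ∧ s.i < X.card ∧ c ≤ 3 + 19 * s.i := by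
  have hcard : ∀ i s, SepInv nx X r γ q i s → i < X.card := by
    intro i s h
    have h₁ := Finset.card_le_card (ball_subset (nx := nx) hr i)
    have h₂ : i ≤ ∑ j ∈ Finset.range i, (sphere nx X r j).card := by
      calc i = ∑ j ∈ Finset.range i, 1 := by simp
        _ ≤ _ := Finset.sum_le_sum fun j hj =>
          Finset.card_pos.2 (h.sphere_nonempty j (Finset.mem_range.1 hj))
    rw [card_ball] at h₁
    omega
  refine (Spec.whileM (kc := 3) (kb := 16) (B := X.card) (I := SepInv nx X r γ q) (G := G)
    (fun i s h => (hcard i s h).le) (fun i s _ => hc s) ?_ ?_).mono ?_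
  · intro i s h hGs
    refine sepBody_spec h ?_
    obtain ⟨x, hx, hxK⟩ := Finset.not_subset.1 (hG s hGs)
    rw [h.K_eq] at hx hxK
    rw [Finset.mem_inter] at hx
    exact ⟨x, Finset.mem_inter.2 ⟨Finset.mem_sdiff.2 ⟨hx.1, hxK⟩, hx.2⟩⟩
  · exact ⟨rfl, rfl, rfl, fun _ h => absurd h (Nat.not_lt_zero _),
      Or.inl ⟨rfl, fun _ h => absurd h (Nat.not_lt_zero _)⟩,
      Or.inl ⟨rfl, fun _ h => absurd h (Nat.not_lt_zero _)⟩⟩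
  · rintro s c ⟨j, h₁, h₂, h₃⟩
    obtain rfl := h₁.i_eq
    exact ⟨h₁, h₂, hcard _ _ h₁, h₃⟩

theorem sepCond_spec (nx : Finset α → Finset α) (X : Finset α) (s : SepState α) :
    Spec (sepCond (fun S => one (nx S)) X s) fun b c =>
      c ≤ 3 ∧ (b = true ↔ ¬ nx s.K ∩ X ⊆ s.K) := by
  iterate 3 refine Spec.one_bind ?_
  rw [Spec.pure_iff]
  refine ⟨le_rfl, ?_⟩
  rw [Bool.not_eq_true', decide_eq_false_iff_not]

theorem eq_ball_of_closed {P : SymGraph α} {nx : Finset α → Finset α} {X : Finset α} {r : α}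
    (hX : P.StronglyConnected X) (hnx : Expands P nx) (hr : r ∈ X) {i : ℕ}
    (h : nx (ball nx X r i) ∩ X ⊆ ball nx X r i) : X ⊆ ball nx X r i := by
  intro v hv
  by_contra hvB
  obtain ⟨x, hx, hx', hxB⟩ := hnx X _ hX r hr
    (ball_mono (Nat.zero_le i) (Finset.mem_singleton_self r)) v hv hvB
  exact hxB (h (Finset.mem_inter.2 ⟨hx', hx⟩))

/-- A search that reaches index `γ` always yields a non-empty set. So the result is empty only if
both searches exhaust `X` in fewer than `γ` steps; passing through `r` then bounds the diameter, and
the cost is of order `γ`. -/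
theorem separator_spec {P : SymGraph α} {X : Finset α} {r : α} {γ : ℕ}
    (hX : P.StronglyConnected X) (hr : r ∈ X) (hq : 1 ≤ quality γ X.card) :
    Spec (separator P X r γ) fun T c => c ≤ 7 + 38 * X.card ∧
      (T = ∅ → c ≤ 7 + 38 * γ ∧ P.DiamLE X (2 * γ)) ∧
      (T ≠ ∅ → IsSeparator P X (quality γ X.card) T) := by
  refine Spec.one_bind (Spec.bind (sepSearch_spec (nx := succs P) (γ := γ)
    (q := quality γ X.card) hr (sepCond_spec _ _) fun _ h => h) ?_)
  rintro s₁ c₁ ⟨h₁, hcl₁, hs₁, hc₁⟩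
  have hfin : ∀ (nx : Finset α → Finset α) (s : SepState α), Expands P nx →
      SepInv nx X r γ (quality γ X.card) s.i s → s.i < X.card → ∀ c : ℕ, c ≤ 7 + 38 * X.card →
      (s.i < γ → c ≤ 7 + 38 * γ ∧ P.DiamLE X (2 * γ)) →
      Spec (if s.i < γ then pure ∅ else
        if (s.c : ℝ) < (X.card : ℝ) / 2 then pure s.L else pure s.R : SymM (Finset α))
        fun T c' => c + c' ≤ 7 + 38 * X.card ∧
          (T = ∅ → c + c' ≤ 7 + 38 * γ ∧ P.DiamLE X (2 * γ)) ∧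
          (T ≠ ∅ → IsSeparator P X (quality γ X.card) T) := by
    intro nx s hnx hs hsi c hc hlt
    refine Spec.ite_iff.2 ⟨fun h => ?_, fun h => ?_⟩
    · rw [Spec.pure_iff]
      exact ⟨hc, fun _ => hlt h, fun hne => absurd rfl hne⟩
    · have hsep := hs.isSeparator hnx hr hq (not_lt.1 h)
      refine Spec.ite_iff.2 ⟨fun h' => ?_, fun h' => ?_⟩
      · rw [if_pos h'] at hsep
        rw [Spec.pure_iff]
        exact ⟨hc, fun hT => absurd hT hsep.1.ne_empty, fun _ => hsep⟩
      · rw [if_neg h'] at hsep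
        rw [Spec.pure_iff]
        exact ⟨hc, fun hT => absurd hT hsep.1.ne_empty, fun _ => hsep⟩
  refine Spec.ite_iff.2 ⟨fun hi => ?_, fun hi => ?_⟩
  · refine Spec.bind (sepSearch_spec (nx := preds P) (γ := γ) (q := quality γ X.card)
      (G := fun s => s.i ≤ γ ∧ ¬ preds P s.K ∩ X ⊆ s.K) hr ?_ fun _ h => h.2) ?_
    · intro s
      refine Spec.ite_iff.2 ⟨fun h => ?_, fun h => ?_⟩
      · exact (sepCond_spec _ _ _).mono fun b c ⟨h₁, h₂⟩ => ⟨h₁, h₂.trans (and_iff_right h).symm⟩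
      · rw [Spec.pure_iff]
        simp [h]
    rintro s₂ c₂ ⟨h₂, hcl₂, hs₂, hc₂⟩
    refine (hfin _ s₂ (expands_preds P) h₂ hs₂ (1 + c₁ + c₂) (by omega) fun hi₂ => ?_).mono ?_
    · refine ⟨by omega, fun u hu v hv => ?_⟩
      have hc₁' := not_not.1 hcl₁
      -- Since `s₂.i < γ`, the loop ended because the search was exhausted and not because of the
      -- guard `i ≤ γ`.
      have hc₂' := not_not.1 fun h => hcl₂ ⟨hi₂.le, h⟩
      rw [h₁.K_eq] at hc₁'
      rw [h₂.K_eq] at hc₂'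
      obtain ⟨m, hm, w⟩ := exists_walk_of_mem_ball_preds hr _ u
        (eq_ball_of_closed hX (expands_preds P) hr hc₂' hu)
      obtain ⟨m', hm', w'⟩ := exists_walk_of_mem_ball_succs hr _ v
        (eq_ball_of_closed hX (expands_succs P) hr hc₁' hv)
      exact ⟨m + m', by omega, w.trans w'⟩
    · intro T c h
      rwa [show c₁ + (c₂ + c) + 1 = 1 + c₁ + c₂ + c by omega]
  · refine (hfin _ s₁ (expands_succs P) h₁ hs₁ (1 + c₁) (by omega)
      fun hi₁ => absurd hi₁ hi).mono fun T c h => ?_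
    rwa [show c₁ + c + 1 = 1 + c₁ + c by omega]

/-! ### The MEC algorithms -/

theorem sum_card_inter_le {l : List (Finset α)} (hl : l.Pairwise Disjoint) (A : Finset α) :
    (l.map fun C => (C ∩ A).card).sum ≤ A.card := by
  induction l generalizing A with
  | nil => exact Nat.zero_le _
  | cons C l ih =>
    rw [List.pairwise_cons] at hl
    have h : (l.map fun D => (D ∩ A).card) = l.map fun D => (D ∩ (A \ C)).card := by
      refine List.map_congr_left fun D hD => ?_
      congr 1
      ext a
      have : a ∈ C → a ∉ D := fun h => Finset.disjoint_left.1 (hl.1 D hD) h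
      simp only [Finset.mem_inter, Finset.mem_sdiff]
      tauto
    rw [List.map_cons, List.sum_cons, h]
    have h₁ := ih hl.2 (A \ C)
    have h₂ := Finset.card_sdiff_add_card_inter A C
    rw [Finset.inter_comm A C] at h₂
    omega

theorem IsSCCList.sum_card_le {P : SymGraph α} {X : Finset α} {l : List (Finset α)}
    (hl : IsSCCList P X l) : (l.map Finset.card).sum ≤ X.card := by
  refine le_trans (le_of_eq ?_) (sum_card_inter_le hl.1 X)
  congr 1
  exact List.map_congr_left fun C hC => by rw [Finset.inter_eq_left.2 (hl.2 C hC).1]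

/-- A part inside `A` has square at most `|A|` times its own size, and the sizes of the parts inside
`A` add up to at most `|A|`. -/
theorem sum_card_sq_le {l : List (Finset α)} (hl : l.Pairwise Disjoint) {A B : Finset α}
    (h : ∀ C ∈ l, C ⊆ A ∨ C ⊆ B) :
    (l.map fun C => C.card ^ 2).sum ≤ A.card ^ 2 + B.card ^ 2 := by
  calc (l.map fun C => C.card ^ 2).sum
      ≤ (l.map fun C => A.card * (C ∩ A).card + B.card * (C ∩ B).card).sum := by
        refine List.sum_le_sum fun C hC => ?_
        rw [sq]
        rcases h C hC with h | h
        · rw [Finset.inter_eq_left.2 h]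
          exact (Nat.mul_le_mul_right _ (Finset.card_le_card h)).trans (Nat.le_add_right _ _)
        · rw [Finset.inter_eq_left.2 h]
          exact (Nat.mul_le_mul_right _ (Finset.card_le_card h)).trans (Nat.le_add_left _ _)
    _ = A.card * (l.map fun C => (C ∩ A).card).sum +
          B.card * (l.map fun C => (C ∩ B).card).sum := by
        rw [List.sum_map_add, List.sum_map_mul_left, List.sum_map_mul_left]
    _ ≤ A.card ^ 2 + B.card ^ 2 := by
        rw [sq, sq]
        exact Nat.add_le_add (Nat.mul_le_mul_left _ (sum_card_inter_le hl A))
          (Nat.mul_le_mul_left _ (sum_card_inter_le hl B))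

theorem IsSCCList.sum_diam_le {P : SymGraph α} {X : Finset α} {l : List (Finset α)}
    (hl : IsSCCList P X l) : (l.map fun C => P.diam C + 1).sum ≤ 2 * X.card := by
  refine le_trans ?_ (Nat.mul_le_mul_left 2 hl.sum_card_le)
  rw [← List.sum_map_mul_left]
  refine List.sum_le_sum fun C hC => ?_
  have h₁ := (hl.2 C hC).2.diam_le_card
  have h₂ := Finset.card_pos.2 (hl.2 C hC).2.1
  omega

/-- The bound on the cost of `SymMec` on a set of `x` vertices, up to a multiple of the diameter. -/
noncomputable def costBound (γ q x : ℕ) : ℝ := 150 * γ * x + 600 / q * (x : ℝ) ^ 2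

theorem sum_costBound {β : Type} (γ q : ℕ) (l : List (Finset β)) :
    (l.map fun C => costBound γ q C.card).sum =
      150 * γ * ((l.map Finset.card).sum : ℕ) +
        600 / q * ((l.map fun C => C.card ^ 2).sum : ℕ) := by
  induction l with
  | nil => simp
  | cons C l ih =>
    rw [List.map_cons, List.sum_cons, ih]
    simp only [List.map_cons, List.sum_cons, Nat.cast_add, Nat.cast_pow, costBound]
    ring

/-- Here `k ^ 2 - a ^ 2 - b ^ 2 = (a + t) * (b + t) + (a * b + a * t + b * t)`, so the drop of the
squares dominates the separated pairs. -/
theorem separator_charge {q a b t k : ℝ} (hq : 0 < q) (ha : 0 ≤ a) (hb : 0 ≤ b) (ht : 0 ≤ t)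
    (hk : a + t + b = k) (h : q * t * k ≤ 2 * (a + t) * (b + t)) :
    300 * (t * k) ≤ 600 / q * (k ^ 2 - a ^ 2 - b ^ 2) := by
  have h₁ : 2 * (a + t) * (b + t) ≤ 2 * (k ^ 2 - a ^ 2 - b ^ 2) := by
    rw [← hk]
    linarith [mul_nonneg ha ht, mul_nonneg hb ht, mul_nonneg ha hb]
  rw [div_mul_eq_mul_div, le_div_iff₀ hq]
  linarith

/-- The specification of the calls of `SymMec` on `S`. -/
def SymMecSpec (ch : ℕ → Finset α → α) (γ q : ℕ) (S : Finset α) : Prop :=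
  ∀ P : SymGraph α, P.StronglyConnected S → Spec (symMec ch γ S P) fun r c =>
    r.1 ⊆ S ∧ P.ChangedIn r.2 S ∧ (c : ℝ) + 1 + 34 * (P.diam S + 1) ≤ costBound γ q S.card

/-- The diameters on the left are those in the MDP before any call, so they cancel the cost of the
SCC search that produced `l`. The extra 1 in `SymMecSpec` pays for the union after each call. -/
theorem foldlM_symMec_spec {ch : ℕ → Finset α → α} {γ q : ℕ} {X : Finset α}
    {l : List (Finset α)} (h : ∀ C ∈ l, SymMecSpec ch γ q C) (P : SymGraph α)
    (hl : IsSCCList P X l) {M : Finset α} (hM : M ⊆ X) :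
    Spec (l.foldlM (fun s C => do
        let p ← symMec ch γ C s.2
        let M ← union s.1 p.1
        pure (M, p.2)) (M, P)) fun r c =>
      r.1 ⊆ X ∧ P.ChangedIn r.2 X ∧
        (c : ℝ) + 34 * ((l.map fun C => P.diam C + 1).sum : ℕ) ≤
          (l.map fun C => costBound γ q C.card).sum := by
  induction l generalizing P M with
  | nil =>
    rw [List.foldlM_nil, Spec.pure_iff]
    exact ⟨hM, .refl _ _, by simp⟩
  | cons C l ih =>
    obtain ⟨hl₁, hl₂⟩ := hl
    rw [List.pairwise_cons] at hl₁
    have hC := hl₂ C List.mem_cons_self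
    rw [List.foldlM_cons]
    refine Spec.bind (R := fun r c => r.1 ⊆ X ∧ P.ChangedIn r.2 C ∧
      (c : ℝ) + 34 * (P.diam C + 1) ≤ costBound γ q C.card) ?_ ?_
    · refine Spec.bind (h C List.mem_cons_self P hC.2) ?_
      rintro ⟨M₁, P₁⟩ c ⟨hM₁, hP₁, hc⟩
      refine Spec.one_bind ?_
      rw [Spec.pure_iff]
      refine ⟨Finset.union_subset hM (hM₁.trans hC.1), hP₁, ?_⟩
      push_cast
      linarith
    · rintro ⟨M₁, P₁⟩ c ⟨hM₁, hP₁, hc⟩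
      have hd : ∀ D ∈ l, Disjoint D C := fun D hD => (hl₁.1 D hD).symm
      have hdiam : (l.map fun D => P₁.diam D + 1) = l.map fun D => P.diam D + 1 :=
        List.map_congr_left fun D hD => by rw [hP₁.diam_eq (hd D hD)]
      refine (ih (fun D hD => h D (List.mem_cons_of_mem _ hD)) P₁ ⟨hl₁.2, fun D hD => ?_⟩
        hM₁).mono ?_
      · exact ⟨(hl₂ D (List.mem_cons_of_mem _ hD)).1,
          hP₁.stronglyConnected (hd D hD) (hl₂ D (List.mem_cons_of_mem _ hD)).2⟩
      · rintro r c' ⟨h₁, h₂, h₃⟩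
        refine ⟨h₁, (hP₁.mono hC.1).trans h₂, ?_⟩
        rw [hdiam] at h₃
        simp only [List.map_cons, List.sum_cons]
        push_cast
        push_cast at h₃
        linarith

theorem symMec_spec {ch : ℕ → Finset α → α} (hch : ∀ t A, A.Nonempty → ch t A ∈ A)
    {γ n : ℕ} (hq : 1 ≤ quality γ n) (S : Finset α) (hS : S.card ≤ n) :
    SymMecSpec ch γ (quality γ n) S := by
  induction hd : S.card using Nat.strong_induction_on generalizing S with
  | _ d ih =>
  subst hd
  intro P hP
  set q := quality γ n with hqdef
  have hq' : (1 : ℝ) ≤ q := by exact_mod_cast hq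
  have hγ : (2 : ℝ) ≤ γ := by
    have : 2 ≤ γ := by have := two_mul_quality_le hq; omega
    exact_mod_cast this
  have hk₁ : 1 ≤ S.card := Finset.card_pos.2 hP.1
  have hk : (1 : ℝ) ≤ S.card := by exact_mod_cast hk₁
  have hdiam : (P.diam S : ℝ) ≤ S.card := by exact_mod_cast hP.diam_le_card
  have hγk : (2 : ℝ) * S.card ≤ γ * S.card := by nlinarith
  have hsq : (0 : ℝ) ≤ 600 / q * (S.card : ℝ) ^ 2 := by positivity
  rw [symMec]
  refine Spec.one_bind (Spec.ite_iff.2 ⟨fun hS₁ => ?_, fun hS₁ => ?_⟩)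
  · rw [Spec.pure_iff]
    refine ⟨Finset.empty_subset _, .refl _ _, ?_⟩
    unfold costBound
    have : (S.card : ℝ) ≤ 1 := by exact_mod_cast hS₁
    push_cast
    linarith
  refine Spec.bind (rOut_spec P S) ?_
  rintro _ _ ⟨rfl, rfl⟩
  refine Spec.one_bind ?_
  simp only [decide_eq_true_eq]
  refine Spec.ite_iff.2 ⟨fun hout => ?_, fun hout => ?_⟩
  · refine Spec.bind (collapseEC_spec hch hP.1 P) ?_
    rintro P₁ c ⟨hP₁, hc⟩
    rw [Spec.pure_iff]
    refine ⟨subset_rfl, hP₁, ?_⟩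
    have : (c : ℝ) ≤ 21 := by exact_mod_cast hc
    unfold costBound
    push_cast
    linarith
  have hqS : q ≤ quality γ S.card := quality_anti (by omega) hS
  refine Spec.pick_bind hch hP.1 fun r hr => ?_
  refine Spec.bind (separator_spec hP hr (hq.trans hqS)) ?_
  rintro T c₁ ⟨hc₁, hT₁, hT₂⟩
  refine Spec.one_bind ?_
  simp only [decide_eq_true_eq]
  refine Spec.ite_iff.2 ⟨fun hT => ?_, fun hT => ?_⟩
  · obtain ⟨hc₁, hD⟩ := hT₁ hT
    refine Spec.bind (restrict_spec P S) ?_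
    rintro P' _ ⟨hP', rfl⟩
    refine Spec.bind (rOut_spec P S) ?_
    rintro _ _ ⟨rfl, rfl⟩
    refine Spec.bind (attr_spec P' _) ?_
    rintro A c₂ ⟨hA, hAS, hc₂⟩
    rw [hP', Finset.union_eq_right.2 (rOutSet_subset P S)] at hAS
    have hA₁ : 1 ≤ A.card :=
      Finset.card_pos.2 ((Finset.nonempty_iff_ne_empty.2 hout).mono hA)
    have hSA := Finset.card_sdiff_of_subset hAS
    have hAc := Finset.card_le_card hAS
    refine Spec.one_bind (Spec.bind (sccFind_spec hch (Finset.sdiff_subset.trans hP.2.1)) ?_)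
    rintro l c₃ ⟨hl, hc₃⟩
    refine (foldlM_symMec_spec (q := q) (fun C hC => ?_) P hl (Finset.empty_subset _)).mono ?_
    · have hCc := Finset.card_le_card (hl.2 C hC).1
      exact ih _ (by omega) C (by omega) rfl
    rintro ⟨M, P₁⟩ c₄ ⟨hM, hP₁, hc₄⟩
    refine ⟨hM.trans Finset.sdiff_subset, hP₁.mono Finset.sdiff_subset, ?_⟩
    rw [sum_costBound] at hc₄
    have h₁ : (((l.map Finset.card).sum : ℕ) : ℝ) ≤ S.card - A.card := by
      have := hl.sum_card_le
      rw [le_sub_iff_add_le]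
      exact_mod_cast (by omega : (l.map Finset.card).sum + A.card ≤ S.card)
    have h₂ : (((l.map fun C => C.card ^ 2).sum : ℕ) : ℝ) ≤ (S.card : ℝ) ^ 2 := by
      have := sum_card_sq_le hl.1 (A := S) (B := ∅)
        fun C hC => Or.inl ((hl.2 C hC).1.trans Finset.sdiff_subset)
      exact_mod_cast (by simpa using this : (l.map fun C => C.card ^ 2).sum ≤ S.card ^ 2)
    have h₃ := mul_le_mul_of_nonneg_left h₁ (by positivity : (0 : ℝ) ≤ 150 * γ)
    have h₄ := mul_le_mul_of_nonneg_left h₂ (by positivity : (0 : ℝ) ≤ 600 / q)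
    have h₅ : (P.diam S : ℝ) ≤ 2 * γ := by exact_mod_cast hD.diam_le
    have h₆ : (c₁ : ℝ) ≤ 7 + 38 * γ := by exact_mod_cast hc₁
    have h₇ : (c₂ : ℝ) ≤ 7 + 7 * A.card := by
      exact_mod_cast (by omega : c₂ ≤ 7 + 7 * A.card)
    have h₈ : (c₃ : ℝ) ≤ 1 + 34 * ((l.map fun C => P.diam C + 1).sum : ℕ) := by
      exact_mod_cast hc₃
    have h₉ : (1 : ℝ) ≤ A.card := by exact_mod_cast hA₁
    have h₁₀ : (2 : ℝ) * A.card ≤ γ * A.card := by nlinarith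
    have h₁₁ : (γ : ℝ) ≤ γ * A.card := by nlinarith
    -- Outside the recursive calls at most `106 * γ + 7 * |A| + 67` is needed, including the share
    -- of the parent's search. As `γ ≥ 2` and `|A| ≥ 1`, the released `150 * γ * |A|` suffices.
    unfold costBound
    push_cast
    push_cast at hc₄ h₁ h₃ h₄ h₈
    linarith
  · obtain ⟨hTne, hTS, A₀, B₀, hcard, hsep, hqt⟩ := hT₂ hT
    refine Spec.bind (restrict_spec P S) ?_
    rintro P' _ ⟨hP', rfl⟩
    refine Spec.bind (attr_spec P' _) ?_
    rintro A c₂ ⟨hA, hAS, hc₂⟩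
    rw [hP', Finset.union_eq_right.2 hTS] at hAS
    have hT₁ : 1 ≤ T.card := Finset.card_pos.2 hTne
    have hTA := Finset.card_le_card hA
    have hSA := Finset.card_sdiff_of_subset hAS
    have hAc := Finset.card_le_card hAS
    refine Spec.one_bind (Spec.bind (sccFind_spec hch (Finset.sdiff_subset.trans hP.2.1)) ?_)
    rintro l c₃ ⟨hl, hc₃⟩
    refine Spec.bind (foldlM_symMec_spec (q := q) (fun C hC => ?_) P hl (Finset.empty_subset _)) ?_
    · have hCc := Finset.card_le_card (hl.2 C hC).1
      exact ih _ (by omega) C (by omega) rfl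
    rintro ⟨M, P₁⟩ c₄ ⟨hM, hP₁, hc₄⟩
    refine (incDetect_spec hch hTS (fun a ha => ?_) (hM.trans Finset.sdiff_subset)).mono ?_
    -- The recursive calls act inside `S \ A` and `T ⊆ A`, so no vertex of the separator has been
    -- deleted.
    · exact hP₁.1 a (hP.2.1 (hTS ha)) fun h => (Finset.mem_sdiff.1 h).2 (hA ha)
    rintro ⟨M', P₂⟩ c₅ ⟨hM', hP₂, hc₅⟩
    refine ⟨hM', (hP₁.mono Finset.sdiff_subset).trans hP₂, ?_⟩
    rw [sum_costBound] at hc₄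
    have h₁ : (((l.map Finset.card).sum : ℕ) : ℝ) ≤ S.card := by
      exact_mod_cast hl.sum_card_le.trans (Finset.card_le_card Finset.sdiff_subset)
    have h₂ : (((l.map fun C => C.card ^ 2).sum : ℕ) : ℝ) ≤
        (A₀.card : ℝ) ^ 2 + (B₀.card : ℝ) ^ 2 := by
      have := sum_card_sq_le hl.1 (A := A₀) (B := B₀) fun C hC =>
        hsep C ((hl.2 C hC).1.trans Finset.sdiff_subset) (hl.2 C hC).2
          (Finset.disjoint_of_subset_left (hl.2 C hC).1
            (Finset.disjoint_of_subset_right hA Finset.sdiff_disjoint))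
      exact_mod_cast this
    have h₃ := mul_le_mul_of_nonneg_left h₁ (by positivity : (0 : ℝ) ≤ 150 * γ)
    have h₄ := mul_le_mul_of_nonneg_left h₂ (by positivity : (0 : ℝ) ≤ 600 / q)
    have h₆ : (c₁ : ℝ) ≤ 7 + 38 * S.card := by exact_mod_cast hc₁
    have h₇ : (c₂ : ℝ) ≤ 7 + 7 * S.card := by
      exact_mod_cast (by omega : c₂ ≤ 7 + 7 * S.card)
    have h₈ : (c₃ : ℝ) ≤ 1 + 34 * ((l.map fun C => P.diam C + 1).sum : ℕ) := by
      exact_mod_cast hc₃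
    have h₉ : (c₅ : ℝ) ≤ 1 + (39 * S.card + 84) * T.card := by exact_mod_cast hc₅
    have ht : (1 : ℝ) ≤ T.card := by exact_mod_cast hT₁
    have htk : (S.card : ℝ) ≤ T.card * S.card := by nlinarith
    have htk' : (T.card : ℝ) ≤ T.card * S.card := by nlinarith
    have hmain := separator_charge (by linarith) (by positivity) (by positivity) (by positivity)
      (by exact_mod_cast hcard) (by
        exact_mod_cast (Nat.mul_le_mul_right S.card (Nat.mul_le_mul_right T.card hqS)).trans hqt :
          (q : ℝ) * T.card * S.card ≤ 2 * (A₀.card + T.card) * (B₀.card + T.card))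
    -- The work here is at most `39 * |T| * |S| + 79 * |S| + 84 * |T| + 64`, hence at most `300 *
    -- |T| * |S|`, which `hmain` charges to the quadratic term.
    unfold costBound
    push_cast
    push_cast at hc₄ h₁ h₃ h₄ h₈
    linarith

theorem symbolicMec_spec {ch : ℕ → Finset α → α} (hch : ∀ t A, A.Nonempty → ch t A ∈ A)
    {γ : ℕ} {P : SymGraph α} (hq : 1 ≤ quality γ P.V.card) :
    Spec (symbolicMec ch γ P) fun _ c =>
      (c : ℝ) ≤ 2 + 68 * P.V.card + costBound γ (quality γ P.V.card) P.V.card := by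
  refine Spec.bind (sccFind_spec hch subset_rfl) ?_
  rintro l c₁ ⟨hl, hc₁⟩
  refine Spec.bind (foldlM_symMec_spec (fun C hC => symMec_spec hch hq C
    (Finset.card_le_card (hl.2 C hC).1)) P hl (Finset.empty_subset _)) ?_
  rintro ⟨M, P₁⟩ c₂ ⟨hM, -, hc₂⟩
  refine (sccFind_spec hch hM).mono ?_
  rintro l' c₃ ⟨hl', hc₃⟩
  rw [sum_costBound] at hc₂
  have h₁ : (((l.map Finset.card).sum : ℕ) : ℝ) ≤ P.V.card := by exact_mod_cast hl.sum_card_le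
  have h₂ : (((l.map fun C => C.card ^ 2).sum : ℕ) : ℝ) ≤ (P.V.card : ℝ) ^ 2 := by
    have := sum_card_sq_le hl.1 (A := P.V) (B := ∅) fun C hC => Or.inl (hl.2 C hC).1
    exact_mod_cast (by simpa using this : (l.map fun C => C.card ^ 2).sum ≤ P.V.card ^ 2)
  have h₃ := mul_le_mul_of_nonneg_left h₁ (by positivity : (0 : ℝ) ≤ 150 * γ)
  have h₄ := mul_le_mul_of_nonneg_left h₂
    (by positivity : (0 : ℝ) ≤ 600 / (quality γ P.V.card : ℝ))
  have h₅ : (c₁ : ℝ) ≤ 1 + 34 * ((l.map fun C => P.diam C + 1).sum : ℕ) := by exact_mod_cast hc₁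
  have h₆ : (c₃ : ℝ) ≤ 1 + 68 * P.V.card := by
    have := hl'.sum_diam_le
    have := Finset.card_le_card hM
    exact_mod_cast (by omega : c₃ ≤ 1 + 68 * P.V.card)
  unfold costBound
  push_cast
  push_cast at hc₂ h₁ h₃ h₄ h₅
  linarith

end Symbolic

/-! ### The absolute constant. -/

theorem mainTheorem5 :
    ∃ c : ℝ, ∀ (α : Type) [DecidableEq α] (P : MDP α) (γ : ℕ) (ch : ℕ → Finset α → α),
      (∀ (t : ℕ) (A : Finset α), A.Nonempty → ch t A ∈ A) →
      1 ≤ ⌊(γ : ℝ) / (2 * Real.logb 2 P.V.card)⌋₊ →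
        (∀ S : Finset α, P.toSymGraph.StronglyConnected S →
          ∃ M P₁ t, Symbolic.symMec ch γ S P.toSymGraph 0 = some ((M, P₁), t) ∧
            (t : ℝ) ≤ c * ((P.V.card : ℝ) * γ +
              (P.V.card : ℝ) ^ 2 / ⌊(γ : ℝ) / (2 * Real.logb 2 P.V.card)⌋₊)) ∧
        ∃ MECs t, Symbolic.symbolicMec ch γ P.toSymGraph 0 = some (MECs, t) ∧
          (t : ℝ) ≤ c * ((P.V.card : ℝ) * γ +
            (P.V.card : ℝ) ^ 2 / ⌊(γ : ℝ) / (2 * Real.logb 2 P.V.card)⌋₊) := by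
  -- 600 is the coefficient of the quadratic term. The linear terms need less, since `68 * n + 2` is
  -- absorbed into `n * γ` by `γ ≥ 2`.
  refine ⟨600, fun α _ P γ ch hch hq => ?_⟩
  change 1 ≤ Symbolic.quality γ P.V.card at hq
  change (∀ S : Finset α, P.toSymGraph.StronglyConnected S →
      ∃ M P₁ t, Symbolic.symMec ch γ S P.toSymGraph 0 = some ((M, P₁), t) ∧
        (t : ℝ) ≤ 600 * ((P.V.card : ℝ) * γ +
          (P.V.card : ℝ) ^ 2 / (Symbolic.quality γ P.V.card : ℕ))) ∧
    ∃ MECs t, Symbolic.symbolicMec ch γ P.toSymGraph 0 = some (MECs, t) ∧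
      (t : ℝ) ≤ 600 * ((P.V.card : ℝ) * γ +
        (P.V.card : ℝ) ^ 2 / (Symbolic.quality γ P.V.card : ℕ))
  have hn : (2 : ℝ) ≤ P.V.card := by exact_mod_cast Symbolic.two_le_of_quality_pos hq
  have hγ : (2 : ℝ) ≤ γ := by
    have : 2 ≤ γ := by have := Symbolic.two_mul_quality_le hq; omega
    exact_mod_cast this
  have hnγ : (2 : ℝ) * P.V.card ≤ P.V.card * γ := by nlinarith
  have hbound : ∀ x ≤ P.V.card,
      2 + 68 * (P.V.card : ℝ) + Symbolic.costBound γ (Symbolic.quality γ P.V.card) x ≤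
        600 * ((P.V.card : ℝ) * γ + (P.V.card : ℝ) ^ 2 / (Symbolic.quality γ P.V.card : ℕ)) := by
    intro x hx
    have hx' : (x : ℝ) ≤ P.V.card := by exact_mod_cast hx
    have h₁ : 150 * (γ : ℝ) * x ≤ 150 * γ * P.V.card :=
      mul_le_mul_of_nonneg_left hx' (by positivity)
    have h₂ : 600 / (Symbolic.quality γ P.V.card : ℝ) * (x : ℝ) ^ 2 ≤
        600 * ((P.V.card : ℝ) ^ 2 / (Symbolic.quality γ P.V.card : ℕ)) := by
      rw [div_mul_eq_mul_div, ← mul_div_assoc]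
      gcongr
    unfold Symbolic.costBound
    linarith
  constructor
  · intro S hS
    have hSn := Finset.card_le_card hS.2.1
    obtain ⟨⟨M, P₁⟩, t, hrun, -, -, ht⟩ := Symbolic.symMec_spec hch hq S hSn P.toSymGraph hS 0
    rw [Nat.zero_add] at hrun
    refine ⟨M, P₁, t, hrun, le_trans ?_ (hbound _ hSn)⟩
    have : (0 : ℝ) ≤ P.toSymGraph.diam S := Nat.cast_nonneg _
    linarith
  · obtain ⟨MECs, t, hrun, ht⟩ := Symbolic.symbolicMec_spec hch hq 0
    rw [Nat.zero_add] at hrun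
    exact ⟨MECs, t, hrun, ht.trans (hbound _ le_rfl)⟩
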